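/- Let $q\in L^1(\mathbb R)$ be real-valued with $\int_{\mathbb R}q(x)\,dx=0$, and let $q_m\ge 0$ be a constant such that $q(x)+q_m e^{-x^2}\ge 0$ for almost every $x\in\mathbb R$. Let $\lambda_0\le\lambda_1\le\lambda_2\le\cdots$ be the eigenvalues, listed with multiplicity, of the perturbed harmonic oscillator $$-u''(x)+[x^2+q(x)]\,u(x)=\lambda u(x),\qquad x\in\mathbb R,$$ i.e. of the operator on $L^2(\mathbb R)$ associated with the quadratic form $\int_{\mathbb R} (u')^2+(x^2+q)u^2\,dx$ on $H^1(\mathbb R)\cap L^2(\mathbb R,|x^2+q|\,dx)$, and suppose that $\lambda_0>0$, so that the negative powers below are defined. Let $\lambda_k^0=2k+1$, let $$\omega_n=\begin{cases}\dfrac{2n+3}{n+1}\,\dfrac{\Gamma(\frac n2+1)}{\Gamma(\frac{n+1}2)}, & n\text{ odd},\\[2ex](n+1)\,\dfrac{\Gamma(\frac{n+1}2)}{\Gamma(\frac n2+1)}, & n\text{ even},\end{cases}\qquad \varepsilon_n=\omega_n-\sqrt2\,\frac{\Gamma(n+\frac32)}{\Gamma(n+1)}\quad(n\ge 0),$$ and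 $\varepsilon_{-1}=0$. Then for all integers $n\ge 0$ and all real $s>0$, $$\sum_{k=0}^n\lambda_k^{-s}\;\ge\;\sum_{k=0}^n(\lambda_k^0)^{-s}-s\,q_m\sum_{k=0}^n(\lambda_k^0)^{-s-1}(\varepsilon_k-\varepsilon_{k-1}).$$ -/

import Mathlib

open MeasureTheory

noncomputable section

namespace PerturbedOscillator

/-- The form domain `H¹(ℝ) ∩ L²(ℝ, |V| dx)` of the Schrödinger operator `-d²/dx² + V`.
A function in `H¹(ℝ)` is represented by its (unique) continuous representative, which is locally
absolutely continuous; its weak derivative is then the classical derivative `deriv u`, which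
exists almost everywhere. -/
structure InFormDomain (V u : ℝ → ℝ) : Prop where
  absolutelyContinuous : ∀ a b : ℝ, AbsolutelyContinuousOnInterval u a b
  memLp : MemLp u 2 volume
  memLp_deriv : MemLp (deriv u) 2 volume
  integrable_potential : Integrable (fun x => V x * u x ^ 2) volume

/-- `u` is a solution in `L²(ℝ)` of `-u'' + V u = μ u` in the form sense: `u` is in the form
domain, and `∫ u' φ' + ∫ V u φ = μ ∫ u φ` for every `φ` in the form domain. (The integrability
of `V u φ` follows from the Cauchy–Schwarz inequality when `V` is measurable.) -/
structure IsEigenSolution (V : ℝ → ℝ) (μ : ℝ) (u : ℝ → ℝ) : Prop where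
  inFormDomain : InFormDomain V u
  integrable_mul : ∀ φ, InFormDomain V φ → Integrable (fun x => V x * u x * φ x) volume
  weak_eq : ∀ φ, InFormDomain V φ →
    (∫ x, deriv u x * deriv φ x) + (∫ x, V x * u x * φ x) = μ * ∫ x, u x * φ x

theorem deriv_add_ae {u v : ℝ → ℝ}
    (hu : ∀ a b : ℝ, AbsolutelyContinuousOnInterval u a b)
    (hv : ∀ a b : ℝ, AbsolutelyContinuousOnInterval v a b) :
    deriv (u + v) =ᵐ[volume] deriv u + deriv v := by
  have key : ∀ {w : ℝ → ℝ}, (∀ a b : ℝ, AbsolutelyContinuousOnInterval w a b) →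
      ∀ᵐ x, DifferentiableAt ℝ w x := by
    intro w hw
    have h : ∀ᵐ x : ℝ, ∀ n : ℕ, x ∈ Set.uIcc (-(n : ℝ)) n → DifferentiableAt ℝ w x :=
      ae_all_iff.2 fun n => (hw (-(n : ℝ)) n).ae_differentiableAt
    filter_upwards [h] with x hx
    obtain ⟨n, hn⟩ := exists_nat_ge |x|
    refine hx n ?_
    rw [Set.uIcc_of_le (by linarith [abs_nonneg x])]
    exact abs_le.1 hn
  filter_upwards [key hu, key hv] with x hx hy
  exact deriv_add hx hy

theorem deriv_smul_eq (c : ℝ) (u : ℝ → ℝ) : deriv (c • u) = c • deriv u := by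
  ext x
  simp [deriv_const_smul_field]

theorem IsEigenSolution.zero (V : ℝ → ℝ) (μ : ℝ) : IsEigenSolution V μ 0 where
  inFormDomain :=
    { absolutelyContinuous := fun a b => by
        simpa using! (LipschitzOnWith.absolutelyContinuousOnInterval (K := 0)
          (f := fun _ : ℝ => (0 : ℝ)) (a := a) (b := b) (by
            intro x _ y _
            simp))
      memLp := MemLp.zero
      memLp_deriv := by
        have : deriv (0 : ℝ → ℝ) = 0 := by
          ext x
          exact deriv_const x 0
        rw [this]
        exact MemLp.zero
      integrable_potential := by simp }
  integrable_mul := fun φ _ => by simp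
  weak_eq := fun φ _ => by
    have : deriv (0 : ℝ → ℝ) = 0 := by
      ext x
      exact deriv_const x 0
    simp [this]

theorem IsEigenSolution.add {V : ℝ → ℝ} {μ : ℝ} {u v : ℝ → ℝ}
    (hu : IsEigenSolution V μ u) (hv : IsEigenSolution V μ v) :
    IsEigenSolution V μ (u + v) where
  inFormDomain :=
    { absolutelyContinuous := fun a b =>
        (hu.inFormDomain.absolutelyContinuous a b).add (hv.inFormDomain.absolutelyContinuous a b)
      memLp := hu.inFormDomain.memLp.add hv.inFormDomain.memLp
      memLp_deriv := (memLp_congr_ae (deriv_add_ae hu.inFormDomain.absolutelyContinuous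
        hv.inFormDomain.absolutelyContinuous)).2
          (hu.inFormDomain.memLp_deriv.add hv.inFormDomain.memLp_deriv)
      integrable_potential := by
        have h := (hu.inFormDomain.integrable_potential.add
          hv.inFormDomain.integrable_potential).add
          ((hu.integrable_mul v hv.inFormDomain).const_mul 2)
        refine h.congr (Filter.Eventually.of_forall fun x => ?_)
        simp only [Pi.add_apply]
        ring }
  integrable_mul := fun φ hφ => by
    refine ((hu.integrable_mul φ hφ).add (hv.integrable_mul φ hφ)).congr
      (Filter.Eventually.of_forall fun x => ?_)
    simp only [Pi.add_apply]
    ring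
  weak_eq := fun φ hφ => by
    have h1 : ∫ x, deriv (u + v) x * deriv φ x =
        (∫ x, deriv u x * deriv φ x) + ∫ x, deriv v x * deriv φ x := by
      have i1 : Integrable (fun x => deriv u x * deriv φ x) :=
        hu.inFormDomain.memLp_deriv.integrable_mul hφ.memLp_deriv
      have i2 : Integrable (fun x => deriv v x * deriv φ x) :=
        hv.inFormDomain.memLp_deriv.integrable_mul hφ.memLp_deriv
      rw [← integral_add i1 i2]
      refine integral_congr_ae ?_
      filter_upwards [deriv_add_ae hu.inFormDomain.absolutelyContinuous
        hv.inFormDomain.absolutelyContinuous] with x hx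
      rw [hx, Pi.add_apply]
      ring
    have h2 : ∫ x, V x * (u + v) x * φ x =
        (∫ x, V x * u x * φ x) + ∫ x, V x * v x * φ x := by
      rw [← integral_add (hu.integrable_mul φ hφ) (hv.integrable_mul φ hφ)]
      congr 1
      ext x
      simp only [Pi.add_apply]
      ring
    have h3 : ∫ x, (u + v) x * φ x = (∫ x, u x * φ x) + ∫ x, v x * φ x := by
      have i1 : Integrable (fun x => u x * φ x) :=
        hu.inFormDomain.memLp.integrable_mul hφ.memLp
      have i2 : Integrable (fun x => v x * φ x) :=
        hv.inFormDomain.memLp.integrable_mul hφ.memLp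
      rw [← integral_add i1 i2]
      congr 1
      ext x
      simp only [Pi.add_apply]
      ring
    rw [h1, h2, h3, mul_add, ← hu.weak_eq φ hφ, ← hv.weak_eq φ hφ]
    ring

theorem IsEigenSolution.smul {V : ℝ → ℝ} {μ : ℝ} {u : ℝ → ℝ} (c : ℝ)
    (hu : IsEigenSolution V μ u) : IsEigenSolution V μ (c • u) where
  inFormDomain :=
    { absolutelyContinuous := fun a b => (hu.inFormDomain.absolutelyContinuous a b).const_smul c
      memLp := hu.inFormDomain.memLp.const_smul c
      memLp_deriv := by
        rw [deriv_smul_eq]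
        exact hu.inFormDomain.memLp_deriv.const_smul c
      integrable_potential := by
        refine (hu.inFormDomain.integrable_potential.const_mul (c ^ 2)).congr
          (Filter.Eventually.of_forall fun x => ?_)
        simp only [Pi.smul_apply, smul_eq_mul]
        ring }
  integrable_mul := fun φ hφ => by
    refine ((hu.integrable_mul φ hφ).const_mul c).congr
      (Filter.Eventually.of_forall fun x => ?_)
    simp only [Pi.smul_apply, smul_eq_mul]
    ring
  weak_eq := fun φ hφ => by
    have h1 : ∫ x, deriv (c • u) x * deriv φ x = c * ∫ x, deriv u x * deriv φ x := by
      rw [← integral_const_mul, deriv_smul_eq]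
      congr 1
      ext x
      simp only [Pi.smul_apply, smul_eq_mul]
      ring
    have h2 : ∫ x, V x * (c • u) x * φ x = c * ∫ x, V x * u x * φ x := by
      rw [← integral_const_mul]
      congr 1
      ext x
      simp only [Pi.smul_apply, smul_eq_mul]
      ring
    have h3 : ∫ x, (c • u) x * φ x = c * ∫ x, u x * φ x := by
      rw [← integral_const_mul]
      congr 1
      ext x
      simp only [Pi.smul_apply, smul_eq_mul]
      ring
    rw [h1, h2, h3, ← mul_add, hu.weak_eq φ hφ]
    ring

/-- The eigenspace `ker (H - μ)` of the Schrödinger operator `H = -d²/dx² + V`; it is the zero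
space when `μ` is not an eigenvalue. -/
def eigenspace (V : ℝ → ℝ) (μ : ℝ) : Submodule ℝ (ℝ → ℝ) where
  carrier := {u | IsEigenSolution V μ u}
  zero_mem' := IsEigenSolution.zero V μ
  add_mem' := fun hu hv => hu.add hv
  smul_mem' := fun c _ hu => hu.smul c

/-- `lam 0 ≤ lam 1 ≤ …` is the list of all eigenvalues of `-d²/dx² + V`, in non-decreasing order,
each real number being listed exactly as many times as the dimension of its eigenspace. -/
structure IsEigenvalueSequence (V : ℝ → ℝ) (lam : ℕ → ℝ) : Prop where
  monotone : Monotone lam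
  multiplicity : ∀ μ : ℝ,
    Set.encard {k : ℕ | lam k = μ} = Cardinal.toENat (Module.rank ℝ (eigenspace V μ))

/-- The potential of the perturbed harmonic oscillator. -/
def potential (q : ℝ → ℝ) (x : ℝ) : ℝ := x ^ 2 + q x

/-- The eigenvalues `2k + 1` of the quantum harmonic oscillator. -/
def lamZero (k : ℕ) : ℝ := 2 * k + 1

/-- The sequence `ω_n`. -/
def omega (n : ℕ) : ℝ :=
  if Odd n then
    (2 * n + 3 : ℝ) / (n + 1) * (Real.Gamma ((n : ℝ) / 2 + 1) / Real.Gamma (((n : ℝ) + 1) / 2))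
  else
    ((n : ℝ) + 1) * (Real.Gamma (((n : ℝ) + 1) / 2) / Real.Gamma ((n : ℝ) / 2 + 1))

/-- The sequence `ε_n = ω_n - √2 Γ(n + 3/2) / Γ(n + 1)`. -/
def eps (n : ℕ) : ℝ :=
  omega n - Real.sqrt 2 * (Real.Gamma ((n : ℝ) + 3 / 2) / Real.Gamma ((n : ℝ) + 1))

/-- `epsPrev k` is `ε_{k-1}`, with the convention `ε_{-1} = 0`. -/
def epsPrev : ℕ → ℝ
  | 0 => 0
  | k + 1 => eps k

end PerturbedOscillator

end


/-!
Let `h_k` be the normalized Hermite functions and `ρ_n = h_0² + ⋯ + h_n²`. Since `h_0, …, h_n` are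
orthonormal and have energies `λ_k⁰ + ∫ q h_k²`, the Ky Fan inequality gives
`∑_{k ≤ n} (λ_k - λ_k⁰) ≤ ∫ q ρ_n`. The function `ρ_n + h_{n+1}² / 2` has derivative
`-x h_{n+1}²`, so it is largest at `0`, where its value is `ω_n / π`; hence `ρ_n ≤ ω_n / π`.
Integrating this bound against `q + q_m exp (-x²) ≥ 0`, which has integral `q_m √π`, and computing
`∫ exp (-x²) ρ_n` through Gamma functions yields `∫ q ρ_n ≤ q_m ε_n / √π`. The inequality for
negative powers follows from the convexity of `λ ↦ λ^(-s)` and summation by parts.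
-/

noncomputable section

namespace PerturbedOscillator

section CompactForms

open LinearMap (BilinForm)
open scoped InnerProductSpace

variable {E : Type*} [NormedAddCommGroup E] [InnerProductSpace ℝ E] {a b : BilinForm ℝ E}

/-- A closed form, bounded below, whose operator has compact resolvent. The type `E` stands for the
form domain, equipped with the inner product of the ambient Hilbert space; it need not be
complete, and closedness and semiboundedness are both encoded in the compactness of the sublevel
sets. -/
structure IsCompactForm (a : BilinForm ℝ E) : Prop where
  isSymm : a.IsSymm
  isCompact_sublevel : ∀ M : ℝ, IsCompact (Metric.sphere 0 1 ∩ (fun u => a u u) ⁻¹' Set.Iic M)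

/-- The space of weak solutions `u` of `a u · = μ ⟪u, ·⟫`. -/
def formEigenspace (a : BilinForm ℝ E) (μ : ℝ) : Submodule ℝ E :=
  LinearMap.ker (a - μ • innerₗ E)

theorem mem_formEigenspace {μ : ℝ} {u : E} :
    u ∈ formEigenspace a μ ↔ ∀ v, a u v = μ * ⟪u, v⟫_ℝ := by
  simp [formEigenspace, LinearMap.ext_iff, sub_eq_zero]

theorem inner_eq_zero_of_mem_formEigenspace (ha : a.IsSymm) {μ ν : ℝ} (hμν : μ ≠ ν) {u v : E}
    (hu : u ∈ formEigenspace a μ) (hv : v ∈ formEigenspace a ν) : ⟪u, v⟫_ℝ = 0 := by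
  have h : μ * ⟪u, v⟫_ℝ = ν * ⟪u, v⟫_ℝ := by
    rw [← mem_formEigenspace.1 hu, ha.eq, mem_formEigenspace.1 hv, real_inner_comm]
  by_contra h0
  exact hμν (mul_right_cancel₀ h0 h)

theorem mem_formEigenspace_of_forall_mul_norm_sq_le (ha : a.IsSymm) {μ : ℝ} {u : E}
    (hmin : ∀ v, μ * ‖v‖ ^ 2 ≤ a v v) (hu : a u u = μ * ‖u‖ ^ 2) : u ∈ formEigenspace a μ := by
  refine mem_formEigenspace.2 fun v => ?_
  have hcs := LinearMap.BilinForm.apply_mul_apply_le_of_forall_zero_le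
    (a - μ • innerₗ E) (fun v => by simpa [real_inner_self_eq_norm_sq] using hmin v) u v
  simp only [LinearMap.sub_apply, LinearMap.smul_apply, innerₗ_apply_apply,
    smul_eq_mul, real_inner_self_eq_norm_sq, hu, sub_self, zero_mul, ha.eq v u,
    real_inner_comm u v] at hcs
  exact sub_eq_zero.1 (mul_self_eq_zero.1 (hcs.antisymm (mul_self_nonneg _)))

namespace IsCompactForm

theorem lowerSemicontinuousOn (ha : IsCompactForm a) :
    LowerSemicontinuousOn (fun u => a u u) (Metric.sphere 0 1) :=
  lowerSemicontinuousOn_iff_preimage_Iic.2 fun M =>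
    ⟨_, (ha.isCompact_sublevel M).isClosed, by rw [← Set.inter_assoc, Set.inter_self]⟩

theorem add (ha : IsCompactForm a) (hb : b.IsPosSemidef) (hcont : Continuous fun u => b u u) :
    IsCompactForm (a + b) where
  isSymm := ha.isSymm.add hb.isSymm
  isCompact_sublevel M := by
    obtain ⟨F, hF, hFeq⟩ := lowerSemicontinuousOn_iff_preimage_Iic.1
      (ha.lowerSemicontinuousOn.add (hcont.lowerSemicontinuous.lowerSemicontinuousOn _)) M
    refine (ha.isCompact_sublevel M).of_isClosed_subset (s := _ ∩ _) ?_ fun u hu => ⟨hu.1, ?_⟩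
    · exact hFeq ▸ Metric.isClosed_sphere.inter hF
    · exact (le_add_of_nonneg_right (hb.isNonneg.nonneg u)).trans hu.2

theorem exists_isLeast_eigenvalue [Nontrivial E] (ha : IsCompactForm a) :
    ∃ (μ : ℝ) (u : E), ‖u‖ = 1 ∧ u ∈ formEigenspace a μ ∧ ∀ v, μ * ‖v‖ ^ 2 ≤ a v v := by
  obtain ⟨u₀, hu₀⟩ := NormedSpace.sphere_nonempty (x := (0 : E)).2 zero_le_one
  obtain ⟨u, ⟨hu1, huM⟩, humin⟩ :=
    (ha.lowerSemicontinuousOn.mono Set.inter_subset_left).exists_isMinOn (s := _ ∩ _)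
      ⟨u₀, hu₀, le_refl (a u₀ u₀)⟩ (ha.isCompact_sublevel (a u₀ u₀))
  have hsphere : ∀ v : E, ‖v‖ = 1 → a u u ≤ a v v := fun v hv => by
    rcases le_total (a v v) (a u₀ u₀) with h | h
    · exact humin ⟨mem_sphere_zero_iff_norm.2 hv, h⟩
    · exact le_trans huM h
  have hu : ‖u‖ = 1 := mem_sphere_zero_iff_norm.1 hu1
  have hmin : ∀ v, a u u * ‖v‖ ^ 2 ≤ a v v := fun v => by
    rcases eq_or_ne v 0 with rfl | hv
    · simp
    · have h := hsphere (‖v‖⁻¹ • v) (norm_smul_inv_norm (𝕜 := ℝ) hv)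
      simp only [map_smul, LinearMap.smul_apply, smul_eq_mul] at h
      have hv' : 0 < ‖v‖ := norm_pos_iff.2 hv
      field_simp at h
      linarith
  exact ⟨a u u, u, hu, mem_formEigenspace_of_forall_mul_norm_sq_le ha.isSymm hmin (by simp [hu]),
    hmin⟩

/-- Raising the eigenvalues below `μ` to `μ` leaves a form with no eigenvalue below `μ`. -/
theorem mul_norm_sq_le_add_sum (ha : IsCompactForm a) {ι : Type*} [Fintype ι] {e : ι → E}
    (he : Orthonormal ℝ e) {ν : ι → ℝ} {μ : ℝ} (hν : ∀ j, ν j ≤ μ)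
    (hmem : ∀ j, e j ∈ formEigenspace a (ν j))
    (hcomplete : ∀ κ < μ, ∀ u ∈ formEigenspace a κ, (∀ j, ⟪e j, u⟫_ℝ = 0) → u = 0) (v : E) :
    μ * ‖v‖ ^ 2 ≤ a v v + ∑ j, (μ - ν j) * ⟪e j, v⟫_ℝ ^ 2 := by
  classical
  set b : BilinForm ℝ E :=
    ∑ j, (μ - ν j) • BilinForm.linMulLin (innerₗ E (e j)) (innerₗ E (e j)) with hb
  have hb_apply : ∀ u v, b u v = ∑ j, (μ - ν j) * (⟪e j, u⟫_ℝ * ⟪e j, v⟫_ℝ) := fun u v => by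
    simp [hb, LinearMap.sum_apply]
  have hb_self : ∀ u, b u u = ∑ j, (μ - ν j) * ⟪e j, u⟫_ℝ ^ 2 := fun u => by
    simp only [hb_apply, ← sq]
  have hbpos : b.IsPosSemidef :=
    { isSymm := ⟨fun u v => by simp only [hb_apply, mul_comm ⟪_, u⟫_ℝ]⟩
      isNonneg := ⟨fun u => by
        rw [hb_self]
        exact Finset.sum_nonneg fun j _ => mul_nonneg (sub_nonneg.2 (hν j)) (sq_nonneg _)⟩ }
  rcases subsingleton_or_nontrivial E with hE | hE
  · simp [Subsingleton.elim v 0]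
  obtain ⟨κ, u, hu1, hu, hmin⟩ :=
    (ha.add hbpos (by simp only [hb_self]; fun_prop)).exists_isLeast_eigenvalue
  rw [mem_formEigenspace] at hu
  rcases le_or_gt μ κ with hμκ | hκμ
  · calc μ * ‖v‖ ^ 2 ≤ κ * ‖v‖ ^ 2 := by gcongr
      _ ≤ a v v + b v v := hmin v
      _ = _ := by rw [hb_self]
  have hortho : ∀ j, ⟪e j, u⟫_ℝ = 0 := fun j => by
    have h1 : a u (e j) = ν j * ⟪e j, u⟫_ℝ := by
      rw [ha.isSymm.eq, mem_formEigenspace.1 (hmem j)]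
    have h2 : b u (e j) = (μ - ν j) * ⟪e j, u⟫_ℝ := by
      simp [hb_apply, orthonormal_iff_ite.1 he]
    have h3 : (κ - μ) * ⟪e j, u⟫_ℝ = 0 := by
      have := hu (e j)
      rw [LinearMap.add_apply, LinearMap.add_apply, h1, h2, real_inner_comm (e j)] at this
      linarith
    exact (mul_eq_zero.1 h3).resolve_left (sub_ne_zero.2 hκμ.ne)
  have hu0 : u = 0 := hcomplete κ hκμ u
    (mem_formEigenspace.2 fun v => by simpa [hb_apply, hortho] using hu v) hortho
  simp [hu0] at hu1

end IsCompactForm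

theorem nonempty_orthonormalBasis_of_encard_eq {F ι : Type*} [NormedAddCommGroup F]
    [InnerProductSpace ℝ F] {s : Set ι} [Fintype s]
    (hrank : s.encard = Cardinal.toENat (Module.rank ℝ F)) :
    Nonempty (OrthonormalBasis s ℝ F) := by
  have hrank' : Module.rank ℝ F = Fintype.card s := by
    rwa [Set.encard_eq_coe_toFinset_card, Set.toFinset_card, eq_comm,
      Cardinal.toENat_eq_natCast] at hrank
  have : FiniteDimensional ℝ F :=
    Module.rank_lt_aleph0_iff.1 (hrank' ▸ Cardinal.natCast_lt_aleph0)
  exact ⟨(stdOrthonormalBasis ℝ F).reindex (Fintype.equivFinOfCardEq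
    (Module.finrank_eq_of_rank_eq hrank').symm).symm⟩

/-- The real numbers `lam i` are all the eigenvalues of the form `a`, each listed with its
multiplicity. -/
def IsEigenvalueFamily {ι : Type*} (a : BilinForm ℝ E) (lam : ι → ℝ) : Prop :=
  ∀ μ, {i | lam i = μ}.encard = Cardinal.toENat (Module.rank ℝ (formEigenspace a μ))

theorem IsEigenvalueFamily.exists_orthonormal {ι : Type*} {lam : ι → ℝ}
    (hlam : IsEigenvalueFamily a lam) (ha : a.IsSymm) {μ : ℝ} (hfin : {i | lam i < μ}.Finite) :
    ∃ e : {i | lam i < μ} → E, Orthonormal ℝ e ∧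
      (∀ i : {i | lam i < μ}, e i ∈ formEigenspace a (lam i)) ∧
      ∀ κ < μ, ∀ u ∈ formEigenspace a κ, (∀ i, ⟪e i, u⟫_ℝ = 0) → u = 0 := by
  have hbasis : ∀ κ < μ, ∃ f : {i | lam i = κ} → formEigenspace a κ, Orthonormal ℝ f ∧
      ∀ u, (∀ i, ⟪f i, u⟫_ℝ = 0) → u = 0 := fun κ hκ => by
    have : Fintype {i | lam i = κ} :=
      (hfin.subset fun i (hi : lam i = κ) => hi.trans_lt hκ).fintype
    obtain ⟨f⟩ := nonempty_orthonormalBasis_of_encard_eq (hlam κ)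
    exact ⟨f, f.orthonormal, fun u hu => f.sum_repr' u ▸ by simp [hu]⟩
  choose! f hf hf0 using hbasis
  set e : {i | lam i < μ} → E := fun i => f (lam i) ⟨i, rfl⟩
  have he : ∀ κ (hκ : κ < μ) (i : {i | lam i = κ}), e ⟨i, i.2.trans_lt hκ⟩ = f κ i := by
    rintro κ hκ ⟨i, rfl⟩
    rfl
  have hmem : ∀ i : {i | lam i < μ}, e i ∈ formEigenspace a (lam i) := fun i =>
    (f (lam i) ⟨i, rfl⟩).2
  refine ⟨e, ⟨fun i => (hf _ i.2).1 _, fun i j hij => ?_⟩, hmem, fun κ hκ u hu h0 => ?_⟩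
  · rcases eq_or_ne (lam i) (lam j) with h | h
    · change ⟪(f (lam i) ⟨i, rfl⟩ : E), e j⟫_ℝ = 0
      rw [show e j = f (lam i) ⟨j, h.symm⟩ from he _ i.2 ⟨j, h.symm⟩]
      exact (hf _ i.2).2 fun hne => hij (Subtype.ext (Subtype.mk.inj hne))
    · exact inner_eq_zero_of_mem_formEigenspace ha h (hmem i) (hmem j)
  · exact congrArg Subtype.val (hf0 κ hκ ⟨u, hu⟩ fun i => by
      rw [Submodule.coe_inner, ← he κ hκ i]
      exact h0 _)

theorem IsEigenvalueFamily.sum_le {lam : ℕ → ℝ} (hlam : IsEigenvalueFamily a lam)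
    (hmono : Monotone lam) (ha : IsCompactForm a) {ψ : ℕ → E} (hψ : Orthonormal ℝ ψ) (n : ℕ) :
    ∑ k ∈ Finset.range (n + 1), lam k ≤ ∑ k ∈ Finset.range (n + 1), a (ψ k) (ψ k) := by
  have hlow : {k | lam k < lam n} ⊆ Finset.range (n + 1) := fun k hk =>
    Finset.mem_coe.2 (Finset.mem_range_succ_iff.2 (hmono.reflect_lt hk).le)
  have hfin : {k | lam k < lam n}.Finite := (Finset.finite_toSet _).subset hlow
  obtain ⟨e, he, hmem, hcomplete⟩ := hlam.exists_orthonormal ha.isSymm hfin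
  have := hfin.fintype
  have hlift (v : E) := ha.mul_norm_sq_le_add_sum he (fun j => j.2.le) hmem hcomplete v
  have hbessel : ∀ j, ∑ k ∈ Finset.range (n + 1), ⟪e j, ψ k⟫_ℝ ^ 2 ≤ 1 := fun j => by
    simpa [real_inner_comm, he.1 j] using
      hψ.sum_inner_products_le (e j) (s := Finset.range (n + 1))
  have hgap : ∑ k ∈ Finset.range (n + 1), (lam n - lam k) =
      ∑ j : {k | lam k < lam n}, (lam n - lam j) := by
    rw [← Finset.sum_filter_of_ne (p := fun k => lam k < lam n) fun k hk hne =>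
      (hmono (Finset.mem_range_succ_iff.1 hk)).lt_of_ne (sub_ne_zero.1 hne).symm]
    exact Finset.sum_subtype _ (by simpa using fun k hk => hlow hk) _
  have hsum : ∑ _k ∈ Finset.range (n + 1), lam n ≤ ∑ k ∈ Finset.range (n + 1), a (ψ k) (ψ k) +
      ∑ k ∈ Finset.range (n + 1), (lam n - lam k) := calc
    _ ≤ ∑ k ∈ Finset.range (n + 1), (a (ψ k) (ψ k) +
          ∑ j : {k | lam k < lam n}, (lam n - lam j) * ⟪e j, ψ k⟫_ℝ ^ 2) :=
        Finset.sum_le_sum fun k _ => by simpa [hψ.1 k] using hlift (ψ k)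
    _ = ∑ k ∈ Finset.range (n + 1), a (ψ k) (ψ k) +
          ∑ j : {k | lam k < lam n},
            (lam n - lam j) * ∑ k ∈ Finset.range (n + 1), ⟪e j, ψ k⟫_ℝ ^ 2 := by
        rw [Finset.sum_add_distrib, Finset.sum_comm]
        simp only [Finset.mul_sum]
    _ ≤ ∑ k ∈ Finset.range (n + 1), a (ψ k) (ψ k) +
          ∑ j : {k | lam k < lam n}, (lam n - lam j) := by
        gcongr with j
        exact mul_le_of_le_one_right (sub_nonneg.2 j.2.le) (hbessel j)
    _ = _ := by rw [hgap]
  rw [Finset.sum_sub_distrib] at hsum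
  linarith

end CompactForms

section SquareIntegrable

open Filter Topology
open scoped InnerProductSpace

theorem inner_toLp {α : Type*} {m : MeasurableSpace α} {ρ : Measure α} {f g : α → ℝ}
    (hf : MemLp f 2 ρ) (hg : MemLp g 2 ρ) :
    ⟪hf.toLp f, hg.toLp g⟫_ℝ = ∫ x, f x * g x ∂ρ := by
  rw [L2.inner_def]
  refine integral_congr_ae ?_
  filter_upwards [hf.coeFn_toLp, hg.coeFn_toLp] with x hfx hgx
  rw [hfx, hgx, real_inner_eq_re_inner, RCLike.inner_apply, conj_trivial, mul_comm]
  rfl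

theorem sq_integral_mul_le {α : Type*} {m : MeasurableSpace α} {ρ : Measure α} {f g : α → ℝ}
    (hf : MemLp f 2 ρ) (hg : MemLp g 2 ρ) :
    (∫ x, f x * g x ∂ρ) ^ 2 ≤ (∫ x, f x ^ 2 ∂ρ) * ∫ x, g x ^ 2 ∂ρ := by
  simpa only [inner_toLp, ← sq] using real_inner_mul_inner_self_le (hf.toLp f) (hg.toLp g)

theorem exists_subseq_tendsto_inner {H : Type*} [NormedAddCommGroup H] [InnerProductSpace ℝ H]
    [CompleteSpace H] [TopologicalSpace.SeparableSpace H] {f : ℕ → H} {R : ℝ}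
    (hf : ∀ n, ‖f n‖ ≤ R) :
    ∃ (g : H) (φ : ℕ → ℕ), StrictMono φ ∧
      ∀ h, Tendsto (fun n => ⟪f (φ n), h⟫_ℝ) atTop (𝓝 ⟪g, h⟫_ℝ) := by
  obtain ⟨ℓ, -, φ, hφ, hlim⟩ := WeakDual.isSeqCompact_closedBall (𝕜 := ℝ) (E := H) 0 R
    (x := fun n => StrongDual.toWeakDual (InnerProductSpace.toDual ℝ H (f n)))
    (fun n => by simpa using hf n)
  refine ⟨(InnerProductSpace.toDual ℝ H).symm (WeakDual.toStrongDual ℓ), φ, hφ, fun h => ?_⟩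
  simpa using! (WeakDual.eval_continuous h).tendsto ℓ |>.comp hlim

end SquareIntegrable

section FormDomain

open Filter Topology
open LinearMap (BilinForm)
open scoped InnerProductSpace

variable {V u v : ℝ → ℝ}

namespace InFormDomain

theorem continuous (hu : InFormDomain V u) : Continuous u :=
  continuous_iff_continuousAt.2 fun x =>
    (hu.absolutelyContinuous (x - 1) (x + 1)).continuousOn.continuousAt <| by
      rw [Set.uIcc_of_le (by linarith)]
      exact Icc_mem_nhds (by linarith) (by linarith)

theorem sub_eq_integral_deriv (hu : InFormDomain V u) (x y : ℝ) :
    u y - u x = ∫ z in x..y, deriv u z :=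
  (hu.absolutelyContinuous x y).integral_deriv_eq_sub.symm

theorem sq_le_sq_add (hu : InFormDomain V u) {x y : ℝ} (hxy : x ≤ y) :
    u x ^ 2 ≤ u y ^ 2 + ((∫ z, u z ^ 2) + ∫ z, deriv u z ^ 2) := by
  have hint : Integrable fun z => u z ^ 2 + deriv u z ^ 2 :=
    hu.memLp.integrable_sq.add hu.memLp_deriv.integrable_sq
  have hac := hu.absolutelyContinuous x y
  have hbound : |u y * u y - u x * u x| ≤ (∫ z, u z ^ 2) + ∫ z, deriv u z ^ 2 := calc
    _ = |∫ z in x..y, (deriv u z * u z + u z * deriv u z)| := by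
        rw [hac.integral_deriv_mul_eq_sub hac]
    _ ≤ ∫ z in x..y, (u z ^ 2 + deriv u z ^ 2) := by
        refine intervalIntegral.norm_integral_le_of_norm_le (E := ℝ) hxy
          (Eventually.of_forall fun z _ => ?_) hint.intervalIntegrable
        exact abs_le.2 ⟨by linarith [sq_nonneg (u z + deriv u z)],
          by linarith [sq_nonneg (u z - deriv u z)]⟩
    _ ≤ ∫ z, (u z ^ 2 + deriv u z ^ 2) := by
        rw [intervalIntegral.integral_of_le hxy]
        exact setIntegral_le_integral hint (Eventually.of_forall fun z => by positivity)
    _ = _ := integral_add hu.memLp.integrable_sq hu.memLp_deriv.integrable_sq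
  linarith [neg_le_of_abs_le hbound]

theorem sq_le (hu : InFormDomain V u) (x : ℝ) :
    u x ^ 2 ≤ 2 * ((∫ z, u z ^ 2) + ∫ z, deriv u z ^ 2) := by
  have hL2 := hu.memLp.integrable_sq
  set K := (∫ z, u z ^ 2) + ∫ z, deriv u z ^ 2
  calc u x ^ 2 = ∫ _ in Set.Ioc x (x + 1), u x ^ 2 := by simp
    _ ≤ ∫ y in Set.Ioc x (x + 1), (u y ^ 2 + K) :=
        setIntegral_mono_on (integrableOn_const (by simp))
          (hL2.integrableOn.add (integrableOn_const (by simp))) measurableSet_Ioc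
          fun y hy => hu.sq_le_sq_add hy.1.le
    _ = (∫ y in Set.Ioc x (x + 1), u y ^ 2) + K := by
        rw [integral_add hL2.integrableOn (integrableOn_const (by simp))]
        simp
    _ ≤ (∫ y, u y ^ 2) + K := by
        grw [setIntegral_le_integral hL2 (Eventually.of_forall fun z => sq_nonneg _)]
    _ ≤ 2 * K := by
        have : 0 ≤ ∫ z, deriv u z ^ 2 := integral_nonneg fun z => sq_nonneg _
        linarith

/-- No measurability of `V` is required: `V u v` is the product of the integrable function `V u²`
with `v / u`, both sides being `0` where `u` vanishes. -/
theorem integrable_mul_mul (hu : InFormDomain V u) (hv : InFormDomain V v) :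
    Integrable fun x => V x * u x * v x := by
  refine ((hu.integrable_potential.norm.add hv.integrable_potential.norm)).mono'
    ((hu.integrable_potential.aestronglyMeasurable.mul
      (hv.continuous.measurable.mul hu.continuous.measurable.inv).aestronglyMeasurable).congr
        (Eventually.of_forall fun x => ?_)) (Eventually.of_forall fun x => ?_)
  · rcases eq_or_ne (u x) 0 with h | h
    · simp [h]
    · simp only [Pi.mul_apply, Pi.inv_apply]
      field_simp
  · have h : |u x * v x| ≤ u x ^ 2 + v x ^ 2 :=
      abs_le.2 ⟨by nlinarith [sq_nonneg (u x + v x)], by nlinarith [sq_nonneg (u x - v x)]⟩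
    simpa [mul_assoc, mul_add, abs_mul] using mul_le_mul_of_nonneg_left h (abs_nonneg (V x))

theorem add (hu : InFormDomain V u) (hv : InFormDomain V v) : InFormDomain V (u + v) where
  absolutelyContinuous a b := (hu.absolutelyContinuous a b).add (hv.absolutelyContinuous a b)
  memLp := hu.memLp.add hv.memLp
  memLp_deriv := (memLp_congr_ae (deriv_add_ae hu.absolutelyContinuous
    hv.absolutelyContinuous)).2 (hu.memLp_deriv.add hv.memLp_deriv)
  integrable_potential := by
    refine ((hu.integrable_potential.add hv.integrable_potential).add
      ((hu.integrable_mul_mul hv).const_mul 2)).congr (Eventually.of_forall fun x => ?_)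
    simp only [Pi.add_apply]
    ring

theorem const_smul (hu : InFormDomain V u) (c : ℝ) : InFormDomain V (c • u) where
  absolutelyContinuous a b := (hu.absolutelyContinuous a b).const_smul c
  memLp := hu.memLp.const_smul c
  memLp_deriv := deriv_smul_eq c u ▸ hu.memLp_deriv.const_smul c
  integrable_potential := by
    refine (hu.integrable_potential.const_mul (c ^ 2)).congr (Eventually.of_forall fun x => ?_)
    simp only [Pi.smul_apply, smul_eq_mul]
    ring

end InFormDomain

/-- The form domain of `-d²/dx² + V` as a space of functions. -/
def formDomain (V : ℝ → ℝ) : Submodule ℝ (ℝ → ℝ) where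
  carrier := {u | InFormDomain V u}
  zero_mem' := (IsEigenSolution.zero V 0).inFormDomain
  add_mem' := InFormDomain.add
  smul_mem' c _ hu := hu.const_smul c

/-- The form domain of `-d²/dx² + V` with the inner product of `L²(ℝ)`. It is a type synonym of the
subspace `formDomain V`, whose topology is that of pointwise convergence. -/
def FormDomain (V : ℝ → ℝ) : Type := formDomain V

namespace FormDomain

instance : AddCommGroup (FormDomain V) := inferInstanceAs (AddCommGroup (formDomain V))

instance : Module ℝ (FormDomain V) := inferInstanceAs (Module ℝ (formDomain V))

instance : CoeFun (FormDomain V) fun _ => ℝ → ℝ := ⟨Subtype.val⟩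

theorem inFormDomain (u : FormDomain V) : InFormDomain V u := u.2

/-- A function in the form domain, as an element of the type `FormDomain V`. -/
def mk (hu : InFormDomain V u) : FormDomain V := ⟨u, hu⟩

/-- The coercion to functions as a linear map. -/
def coeFnₗ (V : ℝ → ℝ) : FormDomain V →ₗ[ℝ] ℝ → ℝ := (formDomain V).subtype

theorem coeFnₗ_injective : Function.Injective (coeFnₗ V) := Subtype.val_injective

/-- The inclusion of the form domain in `L²(ℝ)`. -/
def toL2 : FormDomain V →ₗ[ℝ] Lp ℝ 2 (volume : Measure ℝ) where
  toFun u := u.inFormDomain.memLp.toLp u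
  map_add' _ _ := rfl
  map_smul' _ _ := rfl

/-- The weak derivative, from the form domain to `L²(ℝ)`. -/
def derivL2 : FormDomain V →ₗ[ℝ] Lp ℝ 2 (volume : Measure ℝ) where
  toFun u := u.inFormDomain.memLp_deriv.toLp (deriv u)
  map_add' u v := (MemLp.toLp_congr _ (u.inFormDomain.memLp_deriv.add v.inFormDomain.memLp_deriv)
    (deriv_add_ae u.inFormDomain.absolutelyContinuous v.inFormDomain.absolutelyContinuous)).trans
      (MemLp.toLp_add _ _)
  map_smul' c u := (MemLp.toLp_congr _ (u.inFormDomain.memLp_deriv.const_smul c)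
    (Eventually.of_forall fun x => congrFun (deriv_smul_eq c u) x)).trans
      (MemLp.toLp_const_smul _ _)

theorem toL2_injective : Function.Injective (toL2 (V := V)) := fun u v h =>
  Subtype.ext ((u.inFormDomain.continuous.ae_eq_iff_eq volume v.inFormDomain.continuous).1
    ((MemLp.toLp_eq_toLp_iff u.inFormDomain.memLp v.inFormDomain.memLp).1 h))

/-- The `L²` inner product on the form domain. -/
abbrev innerCore (V : ℝ → ℝ) : InnerProductSpace.Core ℝ (FormDomain V) where
  inner u v := ⟪toL2 u, toL2 v⟫_ℝ
  conj_inner_symm _ _ := by simp only [conj_trivial, real_inner_comm]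
  re_inner_nonneg _ := inner_self_nonneg
  add_left _ _ _ := by simp only [map_add, inner_add_left]
  smul_left _ _ _ := by simp only [map_smul, real_inner_smul_left, conj_trivial]
  definite _ h := (map_eq_zero_iff toL2 toL2_injective).1 (inner_self_eq_zero.1 h)

instance : NormedAddCommGroup (FormDomain V) := (innerCore V).toNormedAddCommGroup

instance : InnerProductSpace ℝ (FormDomain V) := InnerProductSpace.ofCore (innerCore V).toCore

theorem inner_eq_integral (u v : FormDomain V) : ⟪u, v⟫_ℝ = ∫ x, u x * v x :=
  inner_toLp u.inFormDomain.memLp v.inFormDomain.memLp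

theorem norm_sq_eq_integral (u : FormDomain V) : ‖u‖ ^ 2 = ∫ x, u x ^ 2 := by
  simp only [← real_inner_self_eq_norm_sq, inner_eq_integral, ← sq]

theorem inner_derivL2 (u v : FormDomain V) :
    ⟪derivL2 u, derivL2 v⟫_ℝ = ∫ x, deriv u x * deriv v x :=
  inner_toLp u.inFormDomain.memLp_deriv v.inFormDomain.memLp_deriv

theorem norm_derivL2_sq (u : FormDomain V) : ‖derivL2 u‖ ^ 2 = ∫ x, deriv u x ^ 2 := by
  simp only [← real_inner_self_eq_norm_sq, inner_derivL2, ← sq]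

theorem sq_le (u : FormDomain V) (x : ℝ) : u x ^ 2 ≤ 2 * (‖u‖ ^ 2 + ‖derivL2 u‖ ^ 2) := by
  simpa only [norm_sq_eq_integral, norm_derivL2_sq] using u.inFormDomain.sq_le x

end FormDomain

/-- The form `∫ V u v` of the potential. -/
def potentialForm (V : ℝ → ℝ) : BilinForm ℝ (FormDomain V) :=
  LinearMap.mk₂ ℝ (fun u v => ∫ x, V x * u x * v x)
    (fun u u' v => by
      rw [← integral_add (u.inFormDomain.integrable_mul_mul v.inFormDomain)
        (u'.inFormDomain.integrable_mul_mul v.inFormDomain)]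
      exact integral_congr_ae (Eventually.of_forall fun x =>
        show V x * (u x + u' x) * v x = _ by ring))
    (fun c u v => by
      rw [smul_eq_mul, ← integral_const_mul]
      exact integral_congr_ae (Eventually.of_forall fun x =>
        show V x * (c * u x) * v x = _ by ring))
    (fun u v v' => by
      rw [← integral_add (u.inFormDomain.integrable_mul_mul v.inFormDomain)
        (u.inFormDomain.integrable_mul_mul v'.inFormDomain)]
      exact integral_congr_ae (Eventually.of_forall fun x =>
        show V x * u x * (v x + v' x) = _ by ring))
    (fun c u v => by
      rw [smul_eq_mul, ← integral_const_mul]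
      exact integral_congr_ae (Eventually.of_forall fun x =>
        show V x * u x * (c * v x) = _ by ring))

/-- The form `∫ u' v' + ∫ V u v` of the operator `-d²/dx² + V`. -/
def energyForm (V : ℝ → ℝ) : BilinForm ℝ (FormDomain V) :=
  (innerₗ (Lp ℝ 2 (volume : Measure ℝ))).compl₁₂ FormDomain.derivL2 FormDomain.derivL2 +
    potentialForm V

theorem energyForm_apply (u v : FormDomain V) :
    energyForm V u v = (∫ x, deriv u x * deriv v x) + ∫ x, V x * u x * v x :=
  congrArg (· + _) (FormDomain.inner_derivL2 u v)

theorem energyForm_self (u : FormDomain V) :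
    energyForm V u u = ‖FormDomain.derivL2 u‖ ^ 2 + ∫ x, V x * u x ^ 2 := by
  simp only [energyForm_apply, FormDomain.norm_derivL2_sq, mul_assoc, ← sq]

theorem isSymm_energyForm : (energyForm V).IsSymm :=
  ⟨fun u v => by simp only [energyForm_apply, mul_comm (deriv u _), mul_right_comm (V _) (u _)]⟩

theorem eigenspace_eq_map (V : ℝ → ℝ) (μ : ℝ) :
    eigenspace V μ = (formEigenspace (energyForm V) μ).map (FormDomain.coeFnₗ V) := by
  ext u
  constructor
  · intro hu
    refine ⟨FormDomain.mk hu.inFormDomain, mem_formEigenspace.2 fun v => ?_, rfl⟩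
    rw [energyForm_apply, FormDomain.inner_eq_integral]
    exact hu.weak_eq v v.inFormDomain
  · rintro ⟨u, hu, rfl⟩
    refine ⟨u.inFormDomain, fun φ hφ => u.inFormDomain.integrable_mul_mul hφ, fun φ hφ => ?_⟩
    have huφ := mem_formEigenspace.1 hu (FormDomain.mk hφ)
    rwa [energyForm_apply, FormDomain.inner_eq_integral] at huφ

theorem IsEigenvalueSequence.isEigenvalueFamily {lam : ℕ → ℝ} (hlam : IsEigenvalueSequence V lam) :
    IsEigenvalueFamily (energyForm V) lam := fun μ => by
  rw [hlam.multiplicity, eigenspace_eq_map,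
    ← (Submodule.equivMapOfInjective _ FormDomain.coeFnₗ_injective _).rank_eq]

end FormDomain

section Compactness

open Filter Topology
open scoped InnerProductSpace

theorem absolutelyContinuousOnInterval_of_sub_eq_integral {g w : ℝ → ℝ}
    (hg : LocallyIntegrable g volume) (hw : ∀ a b, w b - w a = ∫ z in a..b, g z) (a b : ℝ) :
    AbsolutelyContinuousOnInterval w a b := by
  have hconst : AbsolutelyContinuousOnInterval (fun _ => w a) a b :=
    (LipschitzWith.const (w a)).lipschitzOnWith.absolutelyContinuousOnInterval
  have hint : IntervalIntegrable g volume a b :=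
    (LocallyIntegrable.integrableOn_isCompact hg isCompact_uIcc).intervalIntegrable
  have hprim := hint.absolutelyContinuousOnInterval_intervalIntegral (c := a) Set.left_mem_uIcc
  have hsum : (fun _ => w a) + (fun x => ∫ z in a..x, g z) = w := by
    ext x
    rw [Pi.add_apply, ← hw a x, add_sub_cancel]
  exact hsum ▸ hconst.add hprim

theorem deriv_ae_eq_of_sub_eq_integral {g w : ℝ → ℝ}
    (hg : LocallyIntegrable g volume) (hw : ∀ a b, w b - w a = ∫ z in a..b, g z) :
    deriv w =ᵐ[volume] g := by
  filter_upwards [LocallyIntegrable.ae_hasDerivAt_integral hg] with x hx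
  have hprim := (hx 0).const_add (w 0)
  simp only [← hw, add_sub_cancel] at hprim
  exact hprim.deriv

theorem tendsto_intervalIntegral_of_tendsto_inner {f : ℕ → Lp ℝ 2 (volume : Measure ℝ)}
    {g : Lp ℝ 2 (volume : Measure ℝ)}
    (hfg : ∀ h, Tendsto (fun n => ⟪f n, h⟫_ℝ) atTop (𝓝 ⟪g, h⟫_ℝ)) (a b : ℝ) :
    Tendsto (fun n => ∫ x in a..b, f n x) atTop (𝓝 (∫ x in a..b, g x)) := by
  have hinner : ∀ (a b : ℝ) (h : Lp ℝ 2 (volume : Measure ℝ)),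
      ⟪h, indicatorConstLp 2 (measurableSet_Ioc (a := a) (b := b)) (by simp) 1⟫_ℝ =
        ∫ x in Set.Ioc a b, h x := fun a b h => by
    rw [real_inner_comm, L2.inner_indicatorConstLp_one]
  have hIoc : ∀ a b : ℝ, Tendsto (fun n => ∫ x in Set.Ioc a b, f n x) atTop
      (𝓝 (∫ x in Set.Ioc a b, g x)) := fun a b => by
    simpa only [hinner] using
      hfg (indicatorConstLp 2 (measurableSet_Ioc (a := a) (b := b)) (by simp) 1)
  exact (hIoc a b).sub (hIoc b a)

theorem integrable_and_integral_le_of_tendsto {α : Type*} {m : MeasurableSpace α} {ρ : Measure α}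
    {f : ℕ → α → ℝ} {F : α → ℝ} {c : ℕ → ℝ} {C : ℝ} (hf : ∀ n, Integrable (f n) ρ)
    (hf0 : ∀ n, 0 ≤ᵐ[ρ] f n) (hlim : ∀ᵐ x ∂ρ, Tendsto (fun n => f n x) atTop (𝓝 (F x)))
    (hle : ∀ n, ∫ x, f n x ∂ρ ≤ c n) (hc : Tendsto c atTop (𝓝 C)) :
    Integrable F ρ ∧ ∫ x, F x ∂ρ ≤ C := by
  have hF0 : 0 ≤ᵐ[ρ] F := by
    filter_upwards [hlim, ae_all_iff.2 hf0] with x hx h0 using ge_of_tendsto' hx h0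
  have hFm : AEStronglyMeasurable F ρ :=
    aestronglyMeasurable_of_tendsto_ae _ (fun n => (hf n).aestronglyMeasurable) hlim
  have hC : 0 ≤ C := ge_of_tendsto' hc fun n => (integral_nonneg_of_ae (hf0 n)).trans (hle n)
  have hfatou : ∫⁻ x, ENNReal.ofReal (F x) ∂ρ ≤ ENNReal.ofReal C := calc
    _ ≤ ∫⁻ x, liminf (fun n => ENNReal.ofReal (f n x)) atTop ∂ρ := by
        refine lintegral_mono_ae ?_
        filter_upwards [hlim] with x hx
        exact (ENNReal.tendsto_ofReal hx).liminf_eq.ge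
    _ ≤ liminf (fun n => ∫⁻ x, ENNReal.ofReal (f n x) ∂ρ) atTop :=
        lintegral_liminf_le' fun n => (hf n).aestronglyMeasurable.aemeasurable.ennreal_ofReal
    _ ≤ liminf (fun n => ENNReal.ofReal (c n)) atTop :=
        liminf_le_liminf (Eventually.of_forall fun n => by
          rw [← ofReal_integral_eq_lintegral_ofReal (hf n) (hf0 n)]
          exact ENNReal.ofReal_le_ofReal (hle n))
    _ = ENNReal.ofReal C := (ENNReal.tendsto_ofReal hc).liminf_eq
  refine ⟨(lintegral_ofReal_ne_top_iff_integrable hFm hF0).1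
    (hfatou.trans_lt ENNReal.ofReal_lt_top).ne, ?_⟩
  rw [integral_eq_lintegral_of_nonneg_ae hF0 hFm]
  exact ENNReal.toReal_le_of_le_ofReal hC hfatou

theorem sq_integral_sq_le_integral_inv_mul_integral_mul {α : Type*} {m : MeasurableSpace α}
    {ρ : Measure α} {w d : α → ℝ} (hw : ∀ x, 0 < w x) (hwm : AEStronglyMeasurable w ρ)
    (hdm : AEStronglyMeasurable d ρ) (hinv : Integrable (fun x => (w x)⁻¹ * d x ^ 2) ρ)
    (hint : Integrable (fun x => w x * d x ^ 2) ρ) :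
    (∫ x, d x ^ 2 ∂ρ) ^ 2 ≤ (∫ x, (w x)⁻¹ * d x ^ 2 ∂ρ) * ∫ x, w x * d x ^ 2 ∂ρ := by
  have hsqrtm : AEStronglyMeasurable (fun x => √(w x)) ρ :=
    hwm.aemeasurable.sqrt.aestronglyMeasurable
  have hinvm : AEStronglyMeasurable (fun x => (√(w x))⁻¹) ρ :=
    hsqrtm.aemeasurable.inv.aestronglyMeasurable
  have hsq : ∀ x, (√(w x) * d x) ^ 2 = w x * d x ^ 2 := fun x => by
    rw [mul_pow, Real.sq_sqrt (hw x).le]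
  have hinvsq : ∀ x, ((√(w x))⁻¹ * d x) ^ 2 = (w x)⁻¹ * d x ^ 2 := fun x => by
    rw [mul_pow, inv_pow, Real.sq_sqrt (hw x).le]
  have hmul : ∀ x, (√(w x))⁻¹ * d x * (√(w x) * d x) = d x ^ 2 := fun x => by
    have := Real.sqrt_pos.2 (hw x)
    field_simp
  have h₁ : MemLp (fun x => (√(w x))⁻¹ * d x) 2 ρ :=
    (memLp_two_iff_integrable_sq (hinvm.mul hdm)).2
      (by simpa only [Pi.mul_apply, hinvsq] using hinv)
  have h₂ : MemLp (fun x => √(w x) * d x) 2 ρ :=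
    (memLp_two_iff_integrable_sq (hsqrtm.mul hdm)).2
      (by simpa only [Pi.mul_apply, hsq] using hint)
  simpa only [hmul, hsq, hinvsq] using sq_integral_mul_le h₁ h₂

theorem tendsto_integral_sq_zero_of_integral_weighted_le {d : ℕ → ℝ → ℝ} {B M : ℝ}
    (hdm : ∀ n, AEStronglyMeasurable (d n) volume) (hdB : ∀ n x, d n x ^ 2 ≤ B)
    (hd : ∀ x, Tendsto (fun n => d n x) atTop (𝓝 0))
    (hint : ∀ n, Integrable fun x => (1 + x ^ 2) * d n x ^ 2)
    (hM : ∀ n, ∫ x, (1 + x ^ 2) * d n x ^ 2 ≤ M) :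
    Tendsto (fun n => ∫ x, d n x ^ 2) atTop (𝓝 0) := by
  have hinvm : ∀ n, AEStronglyMeasurable (fun x => (1 + x ^ 2)⁻¹ * d n x ^ 2) volume := fun n =>
    integrable_inv_one_add_sq.aestronglyMeasurable.mul ((hdm n).pow 2)
  have hbound : ∀ n, ∀ᵐ x : ℝ, ‖(1 + x ^ 2)⁻¹ * d n x ^ 2‖ ≤ (1 + x ^ 2)⁻¹ * B := fun n =>
    Eventually.of_forall fun x => by
      rw [Real.norm_of_nonneg (by positivity)]
      grw [hdB n x]
  have hBint : Integrable fun x : ℝ => (1 + x ^ 2)⁻¹ * B := integrable_inv_one_add_sq.mul_const B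
  have hinv : Tendsto (fun n => ∫ x, (1 + x ^ 2)⁻¹ * d n x ^ 2) atTop (𝓝 0) := by
    have h := tendsto_integral_of_dominated_convergence (f := fun _ => (0 : ℝ)) _ hinvm hBint
      hbound (Eventually.of_forall fun x => by simpa using ((hd x).pow 2).const_mul (1 + x ^ 2)⁻¹)
    rwa [integral_zero] at h
  have hcs : ∀ n, (∫ x, d n x ^ 2) ^ 2 ≤ (∫ x, (1 + x ^ 2)⁻¹ * d n x ^ 2) * M := fun n => by
    grw [sq_integral_sq_le_integral_inv_mul_integral_mul (w := fun x => 1 + x ^ 2)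
      (fun x => by positivity) (by fun_prop) (hdm n) (hBint.mono' (hinvm n) (hbound n)) (hint n),
      hM n]
  have hsqrt := (hinv.mul_const M).sqrt
  rw [zero_mul, Real.sqrt_zero] at hsqrt
  exact squeeze_zero (fun n => integral_nonneg fun x => sq_nonneg _)
    (fun n => Real.le_sqrt_of_sq_le (hcs n)) hsqrt

namespace FormDomain

variable {V : ℝ → ℝ} {C : ℝ}

theorem integrable_potential_add_const_mul_sq (C : ℝ) (u : FormDomain V) :
    Integrable fun x => (V x + C) * u x ^ 2 := by
  simpa only [add_mul] using!
    u.inFormDomain.integrable_potential.add (u.inFormDomain.memLp.integrable_sq.const_mul C)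

theorem energyForm_add_mul_norm_sq (C : ℝ) (u : FormDomain V) :
    energyForm V u u + C * ‖u‖ ^ 2 = ‖derivL2 u‖ ^ 2 + ∫ x, (V x + C) * u x ^ 2 := by
  simp only [add_mul]
  rw [integral_add u.inFormDomain.integrable_potential
    (u.inFormDomain.memLp.integrable_sq.const_mul C), integral_const_mul, energyForm_self,
    norm_sq_eq_integral, add_assoc]

theorem integrable_sq_mul_sq (hV : ∀ᵐ x, x ^ 2 ≤ V x + C) (u : FormDomain V) :
    Integrable fun x => x ^ 2 * u x ^ 2 := by
  refine (u.integrable_potential_add_const_mul_sq C).mono'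
    ((continuous_pow 2).mul (u.inFormDomain.continuous.pow 2)).aestronglyMeasurable ?_
  filter_upwards [hV] with x hx
  rw [Real.norm_of_nonneg (by positivity)]
  grw [hx]

theorem norm_derivL2_sq_add_integral_le (hV : ∀ᵐ x, x ^ 2 ≤ V x + C) (u : FormDomain V) :
    ‖derivL2 u‖ ^ 2 + ∫ x, x ^ 2 * u x ^ 2 ≤ energyForm V u u + C * ‖u‖ ^ 2 := by
  rw [energyForm_add_mul_norm_sq]
  gcongr 1
  refine integral_mono_ae (u.integrable_sq_mul_sq hV)
    (u.integrable_potential_add_const_mul_sq C) ?_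
  filter_upwards [hV] with x hx
  grw [hx]

theorem norm_derivL2_sq_le (hV : ∀ᵐ x, x ^ 2 ≤ V x + C) (u : FormDomain V) :
    ‖derivL2 u‖ ^ 2 ≤ energyForm V u u + C * ‖u‖ ^ 2 :=
  le_of_add_le_of_nonneg_left (norm_derivL2_sq_add_integral_le hV u)
    (integral_nonneg fun x => by positivity)

theorem energyForm_sub_add_mul_norm_sq_le (hV : ∀ᵐ x, x ^ 2 ≤ V x + C) (u v : FormDomain V) :
    energyForm V (u - v) (u - v) + C * ‖u - v‖ ^ 2 ≤
      2 * (energyForm V u u + C * ‖u‖ ^ 2) + 2 * (energyForm V v v + C * ‖v‖ ^ 2) := by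
  have hadd : 0 ≤ energyForm V (u + v) (u + v) + C * ‖u + v‖ ^ 2 :=
    (sq_nonneg _).trans (norm_derivL2_sq_le hV (u + v))
  simp only [map_add, map_sub, LinearMap.add_apply, LinearMap.sub_apply, norm_add_sq_real,
    norm_sub_sq_real] at hadd ⊢
  linarith

theorem exists_subseq_limit {u : ℕ → FormDomain V} {R : ℝ} (hu : ∀ n, ‖u n‖ ^ 2 ≤ R)
    (hdu : ∀ n, ‖derivL2 (u n)‖ ^ 2 ≤ R) :
    ∃ (w : ℝ → ℝ) (g : Lp ℝ 2 (volume : Measure ℝ)) (φ : ℕ → ℕ), StrictMono φ ∧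
      (∀ x, Tendsto (fun n => u (φ n) x) atTop (𝓝 (w x))) ∧
      (∀ h, Tendsto (fun n => ⟪derivL2 (u (φ n)), h⟫_ℝ) atTop (𝓝 ⟪g, h⟫_ℝ)) ∧
      ∀ a b, w b - w a = ∫ x in a..b, g x := by
  have : Fact ((2 : ENNReal) ≠ ⊤) := ⟨ENNReal.ofNat_ne_top⟩
  obtain ⟨g, φ, hφ, hg⟩ := exists_subseq_tendsto_inner fun n => Real.le_sqrt_of_sq_le (hdu n)
  have hbound : ∀ n, u (φ n) 0 ∈ Metric.closedBall 0 √(2 * (R + R)) := fun n => by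
    rw [mem_closedBall_zero_iff]
    refine Real.abs_le_sqrt ?_
    grw [(u (φ n)).sq_le 0, hu, hdu]
  obtain ⟨w₀, -, ψ, hψ, hw₀⟩ := tendsto_subseq_of_bounded Metric.isBounded_closedBall hbound
  have hint : ∀ a b : ℝ, IntervalIntegrable g volume a b := fun a b =>
    (LocallyIntegrable.integrableOn_isCompact ((Lp.memLp g).locallyIntegrable (by norm_num))
      isCompact_uIcc).intervalIntegrable
  refine ⟨fun x => w₀ + ∫ z in (0 : ℝ)..x, g z, g, φ ∘ ψ, hφ.comp hψ, fun x => ?_,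
    fun h => (hg h).comp hψ.tendsto_atTop, fun a b => ?_⟩
  · have hderiv := tendsto_intervalIntegral_of_tendsto_inner hg 0 x
    refine (hw₀.add (hderiv.comp hψ.tendsto_atTop)).congr fun n => ?_
    set v := u (φ (ψ n))
    have hv : ∫ z in (0 : ℝ)..x, derivL2 v z = v x - v 0 := by
      rw [v.inFormDomain.sub_eq_integral_deriv]
      exact intervalIntegral.integral_congr_ae
        (v.inFormDomain.memLp_deriv.coeFn_toLp.mono fun z hz _ => hz)
    simp only [Function.comp_apply]
    rw [hv, add_sub_cancel]
  · rw [add_sub_add_left_eq_sub, intervalIntegral.integral_interval_sub_left (hint 0 b) (hint 0 a)]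

theorem tendsto_zero_of_tendsto_apply (hV : ∀ᵐ x, x ^ 2 ≤ V x + C) {d : ℕ → FormDomain V} {R : ℝ}
    (hnorm : ∀ n, ‖d n‖ ^ 2 ≤ R) (henergy : ∀ n, energyForm V (d n) (d n) + C * ‖d n‖ ^ 2 ≤ R)
    (hd : ∀ x, Tendsto (fun n => d n x) atTop (𝓝 0)) : Tendsto d atTop (𝓝 0) := by
  have hweight : ∀ n x, (1 + x ^ 2) * d n x ^ 2 = d n x ^ 2 + x ^ 2 * d n x ^ 2 := fun n x => by
    ring
  have hsup : ∀ n x, d n x ^ 2 ≤ 2 * (R + R) := fun n x => by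
    grw [(d n).sq_le x, norm_derivL2_sq_le hV, henergy, hnorm]
  have hint : ∀ n, Integrable fun x => (1 + x ^ 2) * d n x ^ 2 := fun n => by
    simpa only [hweight] using!
      (d n).inFormDomain.memLp.integrable_sq.add ((d n).integrable_sq_mul_sq hV)
  have hle : ∀ n, ∫ x, (1 + x ^ 2) * d n x ^ 2 ≤ R + R := fun n => by
    simp only [hweight]
    rw [integral_add (d n).inFormDomain.memLp.integrable_sq ((d n).integrable_sq_mul_sq hV),
      ← norm_sq_eq_integral]
    linarith [hnorm n, henergy n, norm_derivL2_sq_add_integral_le hV (d n),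
      sq_nonneg ‖derivL2 (d n)‖]
  have hsq := tendsto_integral_sq_zero_of_integral_weighted_le
    (fun n => (d n).inFormDomain.memLp.aestronglyMeasurable) hsup hd hint hle
  simp only [← norm_sq_eq_integral] at hsq
  simpa [tendsto_zero_iff_norm_tendsto_zero] using hsq.sqrt

theorem exists_limit_energyForm_le (hV : ∀ᵐ x, x ^ 2 ≤ V x + C) {u : ℕ → FormDomain V} {M : ℝ}
    (hu : ∀ n, ‖u n‖ = 1) (hM : ∀ n, energyForm V (u n) (u n) ≤ M)
    {w : ℝ → ℝ} {g : Lp ℝ 2 (volume : Measure ℝ)}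
    (hw : ∀ x, Tendsto (fun n => u n x) atTop (𝓝 (w x)))
    (hg : ∀ h, Tendsto (fun n => ⟪derivL2 (u n), h⟫_ℝ) atTop (𝓝 ⟪g, h⟫_ℝ))
    (hwg : ∀ a b, w b - w a = ∫ x in a..b, g x) :
    ∃ v : FormDomain V, ⇑v = w ∧ energyForm V v v + C * ‖v‖ ^ 2 ≤ M + C := by
  have hloc : LocallyIntegrable g volume := (Lp.memLp g).locallyIntegrable (by norm_num)
  have hderiv : deriv w =ᵐ[volume] g := deriv_ae_eq_of_sub_eq_integral hloc hwg
  have hsub : ∀ n, ∫ x, (V x + C) * u n x ^ 2 ≤ M + C - (2 * ⟪derivL2 (u n), g⟫_ℝ - ‖g‖ ^ 2) :=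
    fun n => by
      have hsum := energyForm_add_mul_norm_sq C (u n)
      rw [hu n] at hsum
      linarith [hM n, norm_sub_sq_real (derivL2 (u n)) g, sq_nonneg ‖derivL2 (u n) - g‖]
  have hlim : Tendsto (fun n => M + C - (2 * ⟪derivL2 (u n), g⟫_ℝ - ‖g‖ ^ 2)) atTop
      (𝓝 (M + C - ‖g‖ ^ 2)) := by
    have := (((hg g).const_mul 2).sub_const (‖g‖ ^ 2)).const_sub (M + C)
    rwa [real_inner_self_eq_norm_sq, two_mul, add_sub_cancel_right] at this
  obtain ⟨hWw, hWle⟩ := integrable_and_integral_le_of_tendsto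
    (fun n => (u n).integrable_potential_add_const_mul_sq C)
    (fun n => hV.mono fun x hx => mul_nonneg ((sq_nonneg x).trans hx) (sq_nonneg _))
    (.of_forall fun x => ((hw x).pow 2).const_mul (V x + C)) hsub hlim
  obtain ⟨hw2, -⟩ := integrable_and_integral_le_of_tendsto (c := fun _ => 1)
    (fun n => (u n).inFormDomain.memLp.integrable_sq) (fun n => .of_forall fun x => sq_nonneg _)
    (.of_forall fun x => (hw x).pow 2) (fun n => by rw [← norm_sq_eq_integral, hu n, one_pow])
    tendsto_const_nhds
  have hwmeas : AEStronglyMeasurable w volume :=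
    aestronglyMeasurable_of_tendsto_ae _
      (fun n => (u n).inFormDomain.memLp.aestronglyMeasurable) (.of_forall hw)
  have hdom : InFormDomain V w :=
    { absolutelyContinuous := absolutelyContinuousOnInterval_of_sub_eq_integral hloc hwg
      memLp := (memLp_two_iff_integrable_sq hwmeas).2 hw2
      memLp_deriv := (Lp.memLp g).ae_eq hderiv.symm
      integrable_potential := by
        refine (hWw.sub (hw2.const_mul C)).congr (.of_forall fun x => ?_)
        simp only [Pi.sub_apply]
        ring }
  have hDg : derivL2 (mk hdom) = g := Lp.ext (hdom.memLp_deriv.coeFn_toLp.trans hderiv)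
  refine ⟨mk hdom, rfl, ?_⟩
  rw [energyForm_add_mul_norm_sq, hDg]
  exact le_sub_iff_add_le'.1 hWle

end FormDomain

theorem isCompactForm_energyForm {V : ℝ → ℝ} {C : ℝ} (hV : ∀ᵐ x, x ^ 2 ≤ V x + C) :
    IsCompactForm (energyForm V) where
  isSymm := isSymm_energyForm
  isCompact_sublevel M := IsSeqCompact.isCompact fun u hu => by
    have hnorm : ∀ n, ‖u n‖ = 1 := fun n => mem_sphere_zero_iff_norm.1 (hu n).1
    have henergy : ∀ n, energyForm V (u n) (u n) ≤ M := fun n => (hu n).2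
    have hderiv : ∀ n, ‖FormDomain.derivL2 (u n)‖ ^ 2 ≤ M + C := fun n => by
      grw [FormDomain.norm_derivL2_sq_le hV, henergy, hnorm, one_pow, mul_one]
    obtain ⟨w, g, φ, hφ, hw, hg, hwg⟩ := FormDomain.exists_subseq_limit
      (fun n => (by rw [hnorm n, one_pow] : ‖u n‖ ^ 2 = 1).trans_le (le_max_left 1 (M + C)))
      (fun n => (hderiv n).trans (le_max_right 1 (M + C)))
    obtain ⟨v, rfl, hv⟩ := FormDomain.exists_limit_energyForm_le hV (fun n => hnorm (φ n))
      (fun n => henergy (φ n)) hw hg hwg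
    have hsubnorm : ∀ n, ‖u (φ n) - v‖ ^ 2 ≤ (1 + ‖v‖) ^ 2 := fun n => by
      grw [norm_sub_le, hnorm]
    have hsubenergy : ∀ n, energyForm V (u (φ n) - v) (u (φ n) - v) + C * ‖u (φ n) - v‖ ^ 2 ≤
        4 * (M + C) := fun n => by
      have hun := henergy (φ n)
      have hsub := FormDomain.energyForm_sub_add_mul_norm_sq_le hV (u (φ n)) v
      rw [hnorm] at hsub
      linarith
    have hlim : Tendsto (fun n => u (φ n)) atTop (𝓝 v) :=
      tendsto_sub_nhds_zero_iff.1 <| FormDomain.tendsto_zero_of_tendsto_apply hV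
        (fun n => (hsubnorm n).trans (le_max_left _ (4 * (M + C))))
        (fun n => (hsubenergy n).trans (le_max_right _ _))
        (fun x => tendsto_sub_nhds_zero_iff.2 (hw x))
    have hvnorm : ‖v‖ = 1 :=
      tendsto_nhds_unique hlim.norm (by simp only [hnorm, tendsto_const_nhds])
    rw [hvnorm, one_pow, mul_one] at hv
    exact ⟨v, ⟨mem_sphere_zero_iff_norm.2 hvnorm, le_of_add_le_add_right hv⟩, φ, hφ, hlim⟩

end Compactness

section HermiteFunctions

open Filter Polynomial

theorem integrable_polynomial_mul_gaussian (P : ℝ[X]) {c : ℝ} (hc : 0 < c) :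
    Integrable fun x => P.eval x * Real.exp (-c * x ^ 2) := by
  induction P using Polynomial.induction_on' with
  | add P Q hP hQ => exact (hP.add hQ).congr (Eventually.of_forall fun x => by simp [add_mul])
  | monomial n r =>
    have hn : (-1 : ℝ) < n := neg_one_lt_zero.trans_le n.cast_nonneg
    simpa only [eval_monomial, Real.rpow_natCast, mul_assoc] using
      (integrable_rpow_mul_exp_neg_mul_sq hc hn).const_mul r

/-- The ladder coefficient `√(2n)`: the operators `x - d/dx` and `x + d/dx` map the `n`-th
normalized Hermite function to `ladder (n + 1)` times the next and `ladder n` times the previous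
one. -/
def ladder (n : ℕ) : ℝ := √(2 * n)

theorem ladder_zero : ladder 0 = 0 := by simp [ladder]

theorem ladder_sq (n : ℕ) : ladder n ^ 2 = 2 * n := Real.sq_sqrt (by positivity)

theorem ladder_succ_ne_zero (n : ℕ) : ladder (n + 1) ≠ 0 := by
  simp only [ladder]
  positivity

/-- The Hermite polynomials, normalized so that the functions `hermiteFun` are orthonormal. -/
def hermitePoly : ℕ → ℝ[X]
  | 0 => C √(1 / √Real.pi)
  | n + 1 => C (ladder (n + 1))⁻¹ * (2 * X * hermitePoly n - derivative (hermitePoly n))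

theorem ladder_mul_hermitePoly_succ (n : ℕ) :
    C (ladder (n + 1)) * hermitePoly (n + 1) =
      2 * X * hermitePoly n - derivative (hermitePoly n) := by
  rw [hermitePoly, ← mul_assoc, ← C_mul, mul_inv_cancel₀ (ladder_succ_ne_zero n), C_1, one_mul]

/-- The truncated index `n - 1` is harmless at `n = 0` because `ladder 0 = 0`. -/
theorem derivative_hermitePoly (n : ℕ) :
    derivative (hermitePoly n) = C (ladder n) * hermitePoly (n - 1) := by
  induction n with
  | zero => simp [hermitePoly, ladder_zero]
  | succ n ih =>
    refine mul_left_cancel₀ (C_ne_zero.2 (ladder_succ_ne_zero n)) ?_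
    have hermite_eq : 2 * X * derivative (hermitePoly n) - derivative (derivative (hermitePoly n)) =
        C (ladder n ^ 2) * hermitePoly n := by
      rw [ih, derivative_C_mul, sq, C_mul, mul_assoc]
      cases n with
      | zero => simp [ladder_zero]
      | succ m =>
        rw [mul_assoc, ladder_mul_hermitePoly_succ, Nat.add_sub_cancel]
        ring
    calc C (ladder (n + 1)) * derivative (hermitePoly (n + 1))
        = 2 * hermitePoly n +
            (2 * X * derivative (hermitePoly n) - derivative (derivative (hermitePoly n))) := by
          rw [← derivative_C_mul, ladder_mul_hermitePoly_succ]
          simp only [derivative_sub, derivative_mul, derivative_ofNat, derivative_X]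
          ring
      _ = C (ladder (n + 1) ^ 2) * hermitePoly n := by
          rw [hermite_eq, ladder_sq, ladder_sq]
          push_cast
          simp only [C_add, C_mul, C_1, C_ofNat]
          ring
      _ = _ := by rw [sq, C_mul, mul_assoc, Nat.add_sub_cancel]

/-- The `n`-th normalized Hermite function, the `n`-th eigenfunction of `-d²/dx² + x²`. -/
def hermiteFun (n : ℕ) (x : ℝ) : ℝ := (hermitePoly n).eval x * Real.exp (-x ^ 2 / 2)

theorem two_mul_mul_hermiteFun (n : ℕ) (x : ℝ) :
    2 * x * hermiteFun n x = ladder (n + 1) * hermiteFun (n + 1) x +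
      ladder n * hermiteFun (n - 1) x := by
  have h := congrArg (eval x) (ladder_mul_hermitePoly_succ n)
  simp only [derivative_hermitePoly, eval_sub, eval_mul, eval_C, eval_X, eval_ofNat] at h
  simp only [hermiteFun]
  linear_combination (-Real.exp (-x ^ 2 / 2)) * h

theorem hasDerivAt_hermiteFun (n : ℕ) (x : ℝ) :
    HasDerivAt (hermiteFun n)
      ((ladder n * hermiteFun (n - 1) x - ladder (n + 1) * hermiteFun (n + 1) x) / 2) x := by
  have hexp : HasDerivAt (fun y : ℝ => Real.exp (-y ^ 2 / 2)) (-x * Real.exp (-x ^ 2 / 2)) x := by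
    refine ((hasDerivAt_pow 2 x).fun_neg.div_const 2).exp.congr_deriv ?_
    push_cast
    ring
  refine (((hermitePoly n).hasDerivAt x).mul hexp).congr_deriv ?_
  have h := two_mul_mul_hermiteFun n x
  simp only [hermiteFun] at h ⊢
  rw [derivative_hermitePoly, eval_mul, eval_C]
  linear_combination -h / 2

theorem contDiff_hermiteFun (n : ℕ) : ContDiff ℝ 1 (hermiteFun n) := by
  have hP := (hermitePoly n).contDiff_aeval (𝕜 := ℝ) 1
  simp only [coe_aeval_eq_eval] at hP
  exact hP.mul (by fun_prop)

theorem continuous_hermiteFun (n : ℕ) : Continuous (hermiteFun n) :=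
  (contDiff_hermiteFun n).continuous

theorem integrable_hermiteFun_mul (i j : ℕ) :
    Integrable fun x => hermiteFun i x * hermiteFun j x := by
  refine (integrable_polynomial_mul_gaussian (hermitePoly i * hermitePoly j) one_pos).congr
    (Eventually.of_forall fun x => ?_)
  have hexp : Real.exp (-1 * x ^ 2) = Real.exp (-x ^ 2 / 2) * Real.exp (-x ^ 2 / 2) := by
    rw [← Real.exp_add]
    ring_nf
  simp only [hermiteFun, eval_mul, hexp]
  ring

theorem memLp_hermiteFun (n : ℕ) : MemLp (hermiteFun n) 2 := by
  rw [memLp_two_iff_integrable_sq (continuous_hermiteFun n).aestronglyMeasurable]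
  simpa only [sq] using integrable_hermiteFun_mul n n

theorem ladder_mul_integral_hermiteFun_succ_mul (i j : ℕ) :
    ladder (i + 1) * ∫ x, hermiteFun (i + 1) x * hermiteFun j x =
      ladder j * ∫ x, hermiteFun i x * hermiteFun (j - 1) x := by
  have hderiv (x : ℝ) : HasDerivAt (hermiteFun i * hermiteFun j)
      (ladder j * (hermiteFun i x * hermiteFun (j - 1) x) -
        ladder (i + 1) * (hermiteFun (i + 1) x * hermiteFun j x)) x := by
    refine ((hasDerivAt_hermiteFun i x).mul (hasDerivAt_hermiteFun j x)).congr_deriv ?_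
    linear_combination hermiteFun i x / 2 * two_mul_mul_hermiteFun j x -
      hermiteFun j x / 2 * two_mul_mul_hermiteFun i x
  have hlower := (integrable_hermiteFun_mul i (j - 1)).const_mul (ladder j)
  have hraise := (integrable_hermiteFun_mul (i + 1) j).const_mul (ladder (i + 1))
  have hzero := integral_eq_zero_of_hasDerivAt_of_integrable hderiv (hlower.sub hraise)
    (integrable_hermiteFun_mul i j)
  rw [integral_sub hlower hraise, integral_const_mul, integral_const_mul] at hzero
  exact (sub_eq_zero.1 hzero).symm

theorem hermiteFun_zero_sq (x : ℝ) : hermiteFun 0 x ^ 2 = Real.exp (-x ^ 2) / √Real.pi := by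
  rw [hermiteFun, hermitePoly, eval_C, mul_pow, Real.sq_sqrt (by positivity), ← Real.exp_nat_mul]
  ring_nf

theorem integral_exp_neg_sq : ∫ x : ℝ, Real.exp (-x ^ 2) = √Real.pi := by
  simpa using integral_gaussian 1

theorem integral_hermiteFun_mul (i j : ℕ) :
    ∫ x, hermiteFun i x * hermiteFun j x = if i = j then 1 else 0 := by
  have hzero (i : ℕ) : ∫ x, hermiteFun (i + 1) x * hermiteFun 0 x = 0 := by
    simpa [ladder_zero, ladder_succ_ne_zero] using ladder_mul_integral_hermiteFun_succ_mul i 0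
  induction i generalizing j with
  | zero =>
    cases j with
    | zero =>
      simp only [← sq, hermiteFun_zero_sq, integral_div, integral_exp_neg_sq, if_pos]
      exact div_self (by positivity)
    | succ j => simpa [mul_comm] using hzero j
  | succ i ih =>
    cases j with
    | zero => exact hzero i
    | succ j =>
      have h := ladder_mul_integral_hermiteFun_succ_mul i (j + 1)
      rw [Nat.add_sub_cancel, ih] at h
      refine mul_left_cancel₀ (ladder_succ_ne_zero i) (h.trans ?_)
      simp only [Nat.add_right_cancel_iff]
      split_ifs with hij
      · rw [hij]
      · simp

theorem integral_hermiteFun_sq (n : ℕ) : ∫ x, hermiteFun n x ^ 2 = 1 := by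
  simpa only [← sq, if_pos] using integral_hermiteFun_mul n n

theorem memLp_deriv_hermiteFun (n : ℕ) : MemLp (deriv (hermiteFun n)) 2 := by
  have h : deriv (hermiteFun n) = fun x =>
      ladder n / 2 * hermiteFun (n - 1) x - ladder (n + 1) / 2 * hermiteFun (n + 1) x :=
    funext fun x => (hasDerivAt_hermiteFun n x).deriv.trans (by ring)
  exact h ▸ ((memLp_hermiteFun (n - 1)).const_mul _).sub ((memLp_hermiteFun (n + 1)).const_mul _)

theorem integrable_sq_mul_hermiteFun_sq (n : ℕ) :
    Integrable fun x => x ^ 2 * hermiteFun n x ^ 2 := by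
  have h : MemLp (fun x => ladder (n + 1) / 2 * hermiteFun (n + 1) x +
      ladder n / 2 * hermiteFun (n - 1) x) 2 :=
    ((memLp_hermiteFun (n + 1)).const_mul _).add ((memLp_hermiteFun (n - 1)).const_mul _)
  refine h.integrable_sq.congr (Eventually.of_forall fun x => ?_)
  linear_combination (-(x * hermiteFun n x) / 2 - (ladder (n + 1) / 2 * hermiteFun (n + 1) x +
    ladder n / 2 * hermiteFun (n - 1) x) / 2) * two_mul_mul_hermiteFun n x

theorem deriv_hermiteFun_sq_add (n : ℕ) (x : ℝ) :
    deriv (hermiteFun n) x ^ 2 + x ^ 2 * hermiteFun n x ^ 2 =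
      n * hermiteFun (n - 1) x ^ 2 + (n + 1) * hermiteFun (n + 1) x ^ 2 := by
  have hn := ladder_sq n
  have hn1 := ladder_sq (n + 1)
  have hx : x * hermiteFun n x = (ladder (n + 1) * hermiteFun (n + 1) x +
      ladder n * hermiteFun (n - 1) x) / 2 := by
    linear_combination two_mul_mul_hermiteFun n x / 2
  push_cast at hn1
  rw [(hasDerivAt_hermiteFun n x).deriv, ← mul_pow, hx]
  linear_combination hermiteFun (n - 1) x ^ 2 / 2 * hn + hermiteFun (n + 1) x ^ 2 / 2 * hn1

theorem integral_energy_hermiteFun (n : ℕ) :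
    (∫ x, deriv (hermiteFun n) x ^ 2) + ∫ x, x ^ 2 * hermiteFun n x ^ 2 = lamZero n := by
  rw [← integral_add (memLp_deriv_hermiteFun n).integrable_sq (integrable_sq_mul_hermiteFun_sq n)]
  simp only [deriv_hermiteFun_sq_add]
  rw [integral_add ((memLp_hermiteFun _).integrable_sq.const_mul _)
    ((memLp_hermiteFun _).integrable_sq.const_mul _), integral_const_mul, integral_const_mul,
    integral_hermiteFun_sq, integral_hermiteFun_sq, lamZero]
  ring

end HermiteFunctions

section Density

/-- The spectral density `∑_{k ≤ n} h_k²` of the first `n + 1` Hermite functions. -/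
def density (n : ℕ) (x : ℝ) : ℝ := ∑ k ∈ Finset.range (n + 1), hermiteFun k x ^ 2

theorem density_succ (n : ℕ) (x : ℝ) :
    density (n + 1) x = density n x + hermiteFun (n + 1) x ^ 2 :=
  Finset.sum_range_succ _ _

theorem density_zero (x : ℝ) : density 0 x = hermiteFun 0 x ^ 2 := by simp [density]

theorem continuous_density (n : ℕ) : Continuous (density n) :=
  continuous_finsetSum _ fun k _ => (continuous_hermiteFun k).pow 2

theorem density_nonneg (n : ℕ) (x : ℝ) : 0 ≤ density n x := Finset.sum_nonneg fun _ _ => sq_nonneg _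

theorem hasDerivAt_hermiteFun_sq (n : ℕ) (x : ℝ) :
    HasDerivAt (fun y => hermiteFun n y ^ 2)
      (ladder n * hermiteFun (n - 1) x * hermiteFun n x -
        ladder (n + 1) * hermiteFun n x * hermiteFun (n + 1) x) x :=
  ((hasDerivAt_hermiteFun n x).fun_pow 2).congr_deriv (by push_cast; ring)

theorem hasDerivAt_density (n : ℕ) (x : ℝ) :
    HasDerivAt (density n) (-(ladder (n + 1) * hermiteFun n x * hermiteFun (n + 1) x)) x := by
  induction n with
  | zero =>
    rw [funext density_zero]
    exact (hasDerivAt_hermiteFun_sq 0 x).congr_deriv (by simp [ladder_zero])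
  | succ n ih =>
    rw [funext (density_succ n)]
    exact (ih.add (hasDerivAt_hermiteFun_sq (n + 1) x)).congr_deriv
      (by simp only [Nat.add_sub_cancel]; ring)

/-- Adding half of the next square makes the derivative of the density of constant sign on each
half-line. -/
theorem hasDerivAt_density_add (n : ℕ) (x : ℝ) :
    HasDerivAt (fun y => density n y + hermiteFun (n + 1) y ^ 2 / 2)
      (-x * hermiteFun (n + 1) x ^ 2) x := by
  refine ((hasDerivAt_density n x).add
    ((hasDerivAt_hermiteFun_sq (n + 1) x).div_const 2)).congr_deriv ?_
  have h := two_mul_mul_hermiteFun (n + 1) x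
  rw [Nat.add_sub_cancel] at h ⊢
  linear_combination hermiteFun (n + 1) x / 2 * h

theorem density_add_le_zero (n : ℕ) (x : ℝ) :
    density n x + hermiteFun (n + 1) x ^ 2 / 2 ≤ density n 0 + hermiteFun (n + 1) 0 ^ 2 / 2 := by
  have hderiv := hasDerivAt_density_add n
  have hdiff : Differentiable ℝ fun y => density n y + hermiteFun (n + 1) y ^ 2 / 2 :=
    fun y => (hderiv y).differentiableAt
  rcases le_total 0 x with hx | hx
  · refine antitoneOn_of_deriv_nonpos (convex_Ici 0) hdiff.continuous.continuousOn
      hdiff.differentiableOn (fun y hy => ?_) Set.self_mem_Ici hx hx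
    rw [interior_Ici] at hy
    rw [(hderiv y).deriv]
    exact mul_nonpos_of_nonpos_of_nonneg (neg_nonpos.2 hy.le) (sq_nonneg _)
  · refine monotoneOn_of_deriv_nonneg (convex_Iic 0) hdiff.continuous.continuousOn
      hdiff.differentiableOn (fun y hy => ?_) hx Set.self_mem_Iic hx
    rw [interior_Iic] at hy
    rw [(hderiv y).deriv]
    exact mul_nonneg (neg_nonneg.2 hy.le) (sq_nonneg _)

theorem hermiteFun_one_zero : hermiteFun 1 0 = 0 := by
  simpa [ladder_zero, ladder_succ_ne_zero 0] using two_mul_mul_hermiteFun 0 0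

theorem hermiteFun_add_two_zero_sq (n : ℕ) :
    (n + 2) * hermiteFun (n + 2) 0 ^ 2 = (n + 1) * hermiteFun n 0 ^ 2 := by
  have h := two_mul_mul_hermiteFun (n + 1) 0
  have h1 := ladder_sq (n + 1)
  have h2 := ladder_sq (n + 1 + 1)
  push_cast at h1 h2
  rw [Nat.add_sub_cancel, mul_zero, zero_mul] at h
  linear_combination (hermiteFun n 0 ^ 2 * h1 - hermiteFun (n + 2) 0 ^ 2 * h2 -
    (ladder (n + 1 + 1) * hermiteFun (n + 1 + 1) 0 - ladder (n + 1) * hermiteFun n 0) * h) / 2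

theorem hermiteFun_odd_zero (m : ℕ) : hermiteFun (2 * m + 1) 0 = 0 := by
  induction m with
  | zero => exact hermiteFun_one_zero
  | succ m ih =>
    have h := hermiteFun_add_two_zero_sq (2 * m + 1)
    rw [ih, zero_pow two_ne_zero, mul_zero] at h
    exact pow_eq_zero_iff two_ne_zero |>.1 ((mul_eq_zero_iff_left (by positivity)).1 h)

theorem hermiteFun_even_zero_sq (m : ℕ) :
    hermiteFun (2 * m) 0 ^ 2 = Real.Gamma (m + 1 / 2) / Real.Gamma (m + 1) / Real.pi := by
  induction m with
  | zero =>
    simp only [mul_zero, hermiteFun_zero_sq, Nat.cast_zero, zero_add, Real.Gamma_one_half_eq,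
      Real.Gamma_one]
    simp [Real.sqrt_div_self']
  | succ m ih =>
    have h := hermiteFun_add_two_zero_sq (2 * m)
    have hm : (m : ℝ) + 1 / 2 ≠ 0 := by positivity
    have hm1 : (m : ℝ) + 1 ≠ 0 := by positivity
    have hΓ : Real.Gamma (m + 1) ≠ 0 := (Real.Gamma_pos_of_pos (by positivity)).ne'
    push_cast at h ⊢
    rw [ih] at h
    rw [Real.Gamma_add_one hm1, add_right_comm, Real.Gamma_add_one hm]
    field_simp at h ⊢
    linear_combination h

theorem density_apply_zero (n : ℕ) :
    density n 0 = (n + 1) * (hermiteFun n 0 ^ 2 + hermiteFun (n + 1) 0 ^ 2) := by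
  induction n with
  | zero => simp [density_zero, hermiteFun_one_zero]
  | succ n ih =>
    rw [density_succ, ih]
    push_cast
    linear_combination -hermiteFun_add_two_zero_sq n

theorem density_apply_zero_add (n : ℕ) :
    density n 0 + hermiteFun (n + 1) 0 ^ 2 / 2 = omega n / Real.pi := by
  rw [density_apply_zero, omega]
  obtain ⟨m, rfl | rfl⟩ := Nat.even_or_odd' n
  · rw [if_neg (by simp), hermiteFun_odd_zero, hermiteFun_even_zero_sq]
    push_cast
    ring_nf
  · rw [if_pos (by simp), hermiteFun_odd_zero, show 2 * m + 1 + 1 = 2 * (m + 1) by ring,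
      hermiteFun_even_zero_sq]
    have hm : (m : ℝ) + 1 ≠ 0 := by positivity
    have hΓ : Real.Gamma (m + 1) ≠ 0 := (Real.Gamma_pos_of_pos (by positivity)).ne'
    have hhalf : (2 * (m : ℝ) + 1) / 2 + 1 = m + 1 + 1 / 2 := by ring
    have hhalf' : (2 * (m : ℝ) + 1 + 1) / 2 = m + 1 := by ring
    push_cast
    rw [hhalf, hhalf', Real.Gamma_add_one hm]
    field_simp
    ring

theorem density_le_omega (n : ℕ) (x : ℝ) : density n x ≤ omega n / Real.pi := by
  have h := density_add_le_zero n x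
  rw [density_apply_zero_add] at h
  linarith [sq_nonneg (hermiteFun (n + 1) x)]

end Density

section GaussianIntegral

open Filter

theorem integrable_exp_neg_sq : Integrable fun x : ℝ => Real.exp (-x ^ 2) := by
  simpa using integrable_exp_neg_mul_sq one_pos

theorem exp_neg_sq_le_one (x : ℝ) : Real.exp (-x ^ 2) ≤ 1 :=
  Real.exp_le_one_iff.2 (neg_nonpos.2 (sq_nonneg x))

theorem integrable_exp_neg_sq_mul {f : ℝ → ℝ} (hf : Integrable f) :
    Integrable fun x => Real.exp (-x ^ 2) * f x :=
  hf.bdd_mul (c := 1) integrable_exp_neg_sq.aestronglyMeasurable <| Eventually.of_forall fun x => by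
    rw [Real.norm_of_nonneg (Real.exp_pos _).le]
    exact exp_neg_sq_le_one x

/-- The function differentiated is `exp (-x²) h_n h_n'`. -/
theorem hasDerivAt_exp_neg_sq_mul_hermiteFun (n : ℕ) (x : ℝ) :
    HasDerivAt (fun y => Real.exp (-y ^ 2) * (hermiteFun n y *
      (y * hermiteFun n y - ladder (n + 1) * hermiteFun (n + 1) y)))
      (2 * (n + 1) * (Real.exp (-x ^ 2) * hermiteFun (n + 1) x ^ 2) -
        (2 * n + 1) * (Real.exp (-x ^ 2) * hermiteFun n x ^ 2)) x := by
  have hn : HasDerivAt (hermiteFun n)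
      (x * hermiteFun n x - ladder (n + 1) * hermiteFun (n + 1) x) x :=
    (hasDerivAt_hermiteFun n x).congr_deriv
      (by linear_combination -two_mul_mul_hermiteFun n x / 2)
  have hn1 : HasDerivAt (hermiteFun (n + 1))
      (ladder (n + 1) * hermiteFun n x - x * hermiteFun (n + 1) x) x := by
    have hx := two_mul_mul_hermiteFun (n + 1) x
    refine (hasDerivAt_hermiteFun (n + 1) x).congr_deriv ?_
    rw [Nat.add_sub_cancel] at hx ⊢
    linear_combination hx / 2
  refine ((hasDerivAt_pow 2 x).fun_neg.exp.mul (hn.fun_mul (((hasDerivAt_id' x).fun_mul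
    hn).fun_sub (hn1.const_mul (ladder (n + 1)))))).congr_deriv ?_
  have hladder := ladder_sq (n + 1)
  push_cast at hladder ⊢
  linear_combination Real.exp (-x ^ 2) * (hermiteFun (n + 1) x ^ 2 - hermiteFun n x ^ 2) * hladder

theorem integral_exp_neg_sq_mul_hermiteFun_succ_sq (n : ℕ) :
    2 * (n + 1) * ∫ x, Real.exp (-x ^ 2) * hermiteFun (n + 1) x ^ 2 =
      (2 * n + 1) * ∫ x, Real.exp (-x ^ 2) * hermiteFun n x ^ 2 := by
  have hsq (k : ℕ) : Integrable fun x => Real.exp (-x ^ 2) * hermiteFun k x ^ 2 :=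
    integrable_exp_neg_sq_mul (memLp_hermiteFun k).integrable_sq
  have hint : Integrable fun x => Real.exp (-x ^ 2) * (hermiteFun n x *
      (x * hermiteFun n x - ladder (n + 1) * hermiteFun (n + 1) x)) := by
    refine integrable_exp_neg_sq_mul ((((integrable_hermiteFun_mul n (n - 1)).const_mul
      (ladder n / 2)).sub ((integrable_hermiteFun_mul n (n + 1)).const_mul
        (ladder (n + 1) / 2))).congr (Eventually.of_forall fun x => ?_))
    simp only [Pi.sub_apply]
    linear_combination -hermiteFun n x / 2 * two_mul_mul_hermiteFun n x
  have hsucc := (hsq (n + 1)).const_mul (2 * (n + 1))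
  have hself := (hsq n).const_mul (2 * n + 1)
  have hzero := integral_eq_zero_of_hasDerivAt_of_integrable
    (hasDerivAt_exp_neg_sq_mul_hermiteFun n) (hsucc.sub hself) hint
  rw [integral_sub hsucc hself, integral_const_mul, integral_const_mul] at hzero
  exact sub_eq_zero.1 hzero

theorem integral_exp_neg_sq_mul_hermiteFun_sq (n : ℕ) :
    ∫ x, Real.exp (-x ^ 2) * hermiteFun n x ^ 2 =
      Real.Gamma (n + 1 / 2) / Real.Gamma (n + 1) / (√2 * √Real.pi) := by
  induction n with
  | zero =>
    have hexp (x : ℝ) : Real.exp (-x ^ 2) * (Real.exp (-x ^ 2) / √Real.pi) =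
        Real.exp (-2 * x ^ 2) / √Real.pi := by
      rw [mul_div_assoc', ← Real.exp_add]
      ring_nf
    simp only [hermiteFun_zero_sq, hexp, integral_div, integral_gaussian, Nat.cast_zero, zero_add,
      Real.Gamma_one, Real.Gamma_one_half_eq, div_one, Real.sqrt_div Real.pi_pos.le]
    rw [div_div]
  | succ n ih =>
    have h := integral_exp_neg_sq_mul_hermiteFun_succ_sq n
    have hn : (n : ℝ) + 1 / 2 ≠ 0 := by positivity
    have hn1 : (n : ℝ) + 1 ≠ 0 := by positivity
    have hΓ : Real.Gamma (n + 1) ≠ 0 := (Real.Gamma_pos_of_pos (by positivity)).ne'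
    refine mul_left_cancel₀ (mul_ne_zero two_ne_zero hn1) (h.trans ?_)
    push_cast
    rw [ih, Real.Gamma_add_one hn1, add_right_comm, Real.Gamma_add_one hn]
    field_simp

theorem integrable_density (n : ℕ) : Integrable (density n) :=
  integrable_finsetSum _ fun k _ => (memLp_hermiteFun k).integrable_sq

theorem integral_exp_neg_sq_mul_density_eq (n : ℕ) :
    ∫ x, Real.exp (-x ^ 2) * density n x =
      (2 * n + 1) * ∫ x, Real.exp (-x ^ 2) * hermiteFun n x ^ 2 := by
  induction n with
  | zero => simp [density_zero]
  | succ n ih =>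
    simp only [density_succ, mul_add]
    rw [integral_add (integrable_exp_neg_sq_mul (integrable_density n))
      (integrable_exp_neg_sq_mul (memLp_hermiteFun _).integrable_sq), ih,
      ← integral_exp_neg_sq_mul_hermiteFun_succ_sq]
    push_cast
    ring

theorem integral_exp_neg_sq_mul_density (n : ℕ) :
    ∫ x, Real.exp (-x ^ 2) * density n x =
      √2 * (Real.Gamma (n + 3 / 2) / Real.Gamma (n + 1)) / √Real.pi := by
  have hn : (n : ℝ) + 1 / 2 ≠ 0 := by positivity
  have hthree : (n : ℝ) + 3 / 2 = n + 1 / 2 + 1 := by ring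
  have hΓ : Real.Gamma (n + 1) ≠ 0 := (Real.Gamma_pos_of_pos (by positivity)).ne'
  rw [integral_exp_neg_sq_mul_density_eq, integral_exp_neg_sq_mul_hermiteFun_sq, hthree,
    Real.Gamma_add_one hn]
  field_simp
  rw [Real.sq_sqrt zero_le_two]

end GaussianIntegral

section Perturbation

open Filter

variable {q : ℝ → ℝ}

theorem omega_div_pi_nonneg (n : ℕ) : 0 ≤ omega n / Real.pi :=
  (density_nonneg n 0).trans (density_le_omega n 0)

theorem integrable_mul_density (hq : Integrable q) (n : ℕ) :
    Integrable fun x => q x * density n x :=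
  hq.mul_bdd (c := omega n / Real.pi) (continuous_density n).aestronglyMeasurable
    (Eventually.of_forall fun x => by
      rw [Real.norm_of_nonneg (density_nonneg n x)]
      exact density_le_omega n x)

theorem hermiteFun_sq_le_density (n : ℕ) (x : ℝ) : hermiteFun n x ^ 2 ≤ density n x :=
  Finset.single_le_sum (f := fun k => hermiteFun k x ^ 2) (fun _ _ => sq_nonneg _)
    (Finset.self_mem_range_succ n)

theorem integrable_mul_hermiteFun_sq (hq : Integrable q) (n : ℕ) :
    Integrable fun x => q x * hermiteFun n x ^ 2 :=
  (integrable_mul_density hq n).mono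
    (hq.aestronglyMeasurable.mul ((continuous_hermiteFun n).pow 2).aestronglyMeasurable)
    (Eventually.of_forall fun x => by
      rw [norm_mul, norm_mul, Real.norm_of_nonneg (sq_nonneg _),
        Real.norm_of_nonneg (density_nonneg n x)]
      gcongr
      exact hermiteFun_sq_le_density n x)

theorem inFormDomain_hermiteFun (hq : Integrable q) (n : ℕ) :
    InFormDomain (potential q) (hermiteFun n) where
  absolutelyContinuous _ _ := (contDiff_hermiteFun n).contDiffOn.absolutelyContinuousOnInterval
  memLp := memLp_hermiteFun n
  memLp_deriv := memLp_deriv_hermiteFun n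
  integrable_potential := by
    simp only [potential, add_mul]
    exact (integrable_sq_mul_hermiteFun_sq n).add (integrable_mul_hermiteFun_sq hq n)

/-- The `n`-th Hermite function as a trial function for the operator `-d²/dx² + x² + q`. -/
def hermiteTrial (hq : Integrable q) (n : ℕ) : FormDomain (potential q) :=
  FormDomain.mk (inFormDomain_hermiteFun hq n)

theorem orthonormal_hermiteTrial (hq : Integrable q) : Orthonormal ℝ (hermiteTrial hq) :=
  orthonormal_iff_ite.2 fun i j =>
    (FormDomain.inner_eq_integral _ _).trans (integral_hermiteFun_mul i j)

theorem energyForm_hermiteTrial (hq : Integrable q) (n : ℕ) :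
    energyForm (potential q) (hermiteTrial hq n) (hermiteTrial hq n) =
      lamZero n + ∫ x, q x * hermiteFun n x ^ 2 := by
  rw [energyForm_self, FormDomain.norm_derivL2_sq, ← integral_energy_hermiteFun, add_assoc,
    ← integral_add (integrable_sq_mul_hermiteFun_sq n) (integrable_mul_hermiteFun_sq hq n)]
  simp only [← add_mul]
  rfl

theorem sum_integral_mul_hermiteFun_sq (hq : Integrable q) (n : ℕ) :
    ∑ k ∈ Finset.range (n + 1), ∫ x, q x * hermiteFun k x ^ 2 = ∫ x, q x * density n x := by
  rw [← integral_finsetSum _ fun k _ => integrable_mul_hermiteFun_sq hq k]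
  simp only [density, Finset.mul_sum]

theorem eps_div_sqrt_pi (n : ℕ) :
    eps n / √Real.pi = omega n / Real.pi * √Real.pi - ∫ x, Real.exp (-x ^ 2) * density n x := by
  rw [integral_exp_neg_sq_mul_density, eps, sub_div, div_mul, Real.div_sqrt]

variable {qm : ℝ}

theorem integral_mul_density_le (hq : Integrable q)
    (hqpos : ∀ᵐ x, 0 ≤ q x + qm * Real.exp (-x ^ 2)) (n : ℕ) :
    ∫ x, q x * density n x ≤ omega n / Real.pi * (∫ x, q x) + qm / √Real.pi * eps n := by
  have hqρ := integrable_mul_density hq n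
  have hgρ := (integrable_exp_neg_sq_mul (integrable_density n)).const_mul qm
  have hg := integrable_exp_neg_sq.const_mul qm
  have hle : (∫ x, q x * density n x) + qm * ∫ x, Real.exp (-x ^ 2) * density n x ≤
      omega n / Real.pi * ((∫ x, q x) + qm * √Real.pi) := calc
    _ = ∫ x, (q x * density n x + qm * (Real.exp (-x ^ 2) * density n x)) := by
        rw [integral_add hqρ hgρ, integral_const_mul]
    _ ≤ ∫ x, omega n / Real.pi * (q x + qm * Real.exp (-x ^ 2)) := by
        refine integral_mono_ae (hqρ.add hgρ) ((hq.add hg).const_mul _) ?_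
        filter_upwards [hqpos] with x hx
        linarith [mul_le_mul_of_nonneg_left (density_le_omega n x) hx]
    _ = _ := by
        rw [integral_const_mul, integral_add hq hg, integral_const_mul, integral_exp_neg_sq]
  rw [mul_comm_div qm, eps_div_sqrt_pi]
  linarith

theorem sq_le_potential_add (hqpos : ∀ᵐ x, 0 ≤ q x + qm * Real.exp (-x ^ 2)) :
    ∀ᵐ x, x ^ 2 ≤ potential q x + |qm| := by
  filter_upwards [hqpos] with x hx
  have hqm : qm * Real.exp (-x ^ 2) ≤ |qm| :=
    (mul_le_mul_of_nonneg_right (le_abs_self qm) (Real.exp_pos _).le).trans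
      (mul_le_of_le_one_right (abs_nonneg qm) (exp_neg_sq_le_one x))
  simp only [potential]
  linarith

theorem sum_sub_lamZero_le (hq : Integrable q)
    (hqpos : ∀ᵐ x, 0 ≤ q x + qm * Real.exp (-x ^ 2)) {lam : ℕ → ℝ}
    (hlam : IsEigenvalueSequence (potential q) lam) (n : ℕ) :
    ∑ k ∈ Finset.range (n + 1), (lam k - lamZero k) ≤
      omega n / Real.pi * (∫ x, q x) + qm / √Real.pi * eps n := by
  have h := hlam.isEigenvalueFamily.sum_le hlam.monotone
    (isCompactForm_energyForm (sq_le_potential_add hqpos)) (orthonormal_hermiteTrial hq) n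
  simp only [energyForm_hermiteTrial] at h
  rw [Finset.sum_add_distrib, sum_integral_mul_hermiteFun_sq hq] at h
  rw [Finset.sum_sub_distrib]
  linarith [integral_mul_density_le hq hqpos n]

end Perturbation

section NegativePowers

theorem rpow_neg_sub_le_rpow_neg {x y s : ℝ} (hx : 0 < x) (hy : 0 < y) (hs : 0 ≤ s) :
    y ^ (-s) - s * (y ^ (-s - 1) * (x - y)) ≤ x ^ (-s) := by
  have hr : 0 < x / y := div_pos hx hy
  have htangent : 1 - s * (x / y - 1) ≤ x ^ (-s) / y ^ (-s) := calc
    _ ≤ Real.log (x / y) * -s + 1 := by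
        linarith [mul_le_mul_of_nonneg_left (Real.log_le_sub_one_of_pos hr) hs]
    _ ≤ Real.exp (Real.log (x / y) * -s) := Real.add_one_le_exp _
    _ = x ^ (-s) / y ^ (-s) := by rw [← Real.rpow_def_of_pos hr, Real.div_rpow hx.le hy.le]
  rw [le_div_iff₀ (Real.rpow_pos_of_pos hy _)] at htangent
  refine le_of_eq_of_le ?_ htangent
  rw [Real.rpow_sub_one hy.ne']
  field_simp

theorem sum_mul_le_sum_mul_of_antitone {w d f : ℕ → ℝ} (hw : Antitone w) (hw0 : ∀ k, 0 ≤ w k)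
    (h : ∀ n, ∑ k ∈ Finset.range (n + 1), d k ≤ ∑ k ∈ Finset.range (n + 1), f k) (n : ℕ) :
    ∑ k ∈ Finset.range (n + 1), w k * d k ≤ ∑ k ∈ Finset.range (n + 1), w k * f k := by
  have hparts (g : ℕ → ℝ) : ∑ k ∈ Finset.range (n + 1), w k * g k =
      w n * ∑ k ∈ Finset.range (n + 1), g k +
        ∑ i ∈ Finset.range n, (w i - w (i + 1)) * ∑ k ∈ Finset.range (i + 1), g k := by
    have hsum := Finset.sum_range_by_parts w g (n + 1)
    simp only [smul_eq_mul, Nat.add_sub_cancel] at hsum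
    rw [hsum, sub_eq_add_neg, ← Finset.sum_neg_distrib]
    simp only [← neg_mul, neg_sub]
  rw [hparts, hparts]
  exact add_le_add (mul_le_mul_of_nonneg_left (h n) (hw0 n)) <| Finset.sum_le_sum fun i _ =>
    mul_le_mul_of_nonneg_left (h i) (sub_nonneg.2 (hw i.le_succ))

theorem sum_rpow_neg_sub_le {lam mu f : ℕ → ℝ} (hlam : ∀ k, 0 < lam k) (hmu : ∀ k, 0 < mu k)
    (hmono : Monotone mu)
    (h : ∀ n, ∑ k ∈ Finset.range (n + 1), (lam k - mu k) ≤ ∑ k ∈ Finset.range (n + 1), f k)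
    {s : ℝ} (hs : 0 ≤ s) (n : ℕ) :
    ∑ k ∈ Finset.range (n + 1), mu k ^ (-s) -
        s * ∑ k ∈ Finset.range (n + 1), mu k ^ (-s - 1) * f k ≤
      ∑ k ∈ Finset.range (n + 1), lam k ^ (-s) := by
  have hanti : Antitone fun k => mu k ^ (-s - 1) := fun i j hij =>
    Real.rpow_le_rpow_of_nonpos (hmu i) (hmono hij) (by linarith)
  calc
    _ ≤ ∑ k ∈ Finset.range (n + 1), mu k ^ (-s) -
          s * ∑ k ∈ Finset.range (n + 1), mu k ^ (-s - 1) * (lam k - mu k) := by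
        gcongr 1
        refine mul_le_mul_of_nonneg_left ?_ hs
        exact sum_mul_le_sum_mul_of_antitone hanti
          (fun k => (Real.rpow_pos_of_pos (hmu k) _).le) h n
    _ = ∑ k ∈ Finset.range (n + 1), (mu k ^ (-s) - s * (mu k ^ (-s - 1) * (lam k - mu k))) := by
        rw [Finset.sum_sub_distrib, Finset.mul_sum]
    _ ≤ _ := Finset.sum_le_sum fun k _ => rpow_neg_sub_le_rpow_neg (hlam k) (hmu k) hs

end NegativePowers

theorem lamZero_pos (k : ℕ) : 0 < lamZero k := by
  rw [lamZero]
  positivity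

theorem monotone_lamZero : Monotone lamZero := fun i j hij => by
  simp only [lamZero]
  gcongr

theorem sum_eps_sub_epsPrev (n : ℕ) :
    ∑ k ∈ Finset.range (n + 1), (eps k - epsPrev k) = eps n := by
  induction n with
  | zero => simp [epsPrev]
  | succ n ih => rw [Finset.sum_range_succ, ih, epsPrev, add_sub_cancel]

theorem theorem6p3_general {q : ℝ → ℝ} (hq : Integrable q) {qm : ℝ}
    (hqpos : ∀ᵐ x, 0 ≤ q x + qm * Real.exp (-x ^ 2)) (hmean : ∫ x, q x ≤ 0)
    {lam : ℕ → ℝ} (hlam : IsEigenvalueSequence (potential q) lam) (hlam0 : 0 < lam 0)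
    (n : ℕ) {s : ℝ} (hs : 0 ≤ s) :
    ∑ k ∈ Finset.range (n + 1), lam k ^ (-s) ≥
      ∑ k ∈ Finset.range (n + 1), lamZero k ^ (-s) -
        s * (qm / √Real.pi) * ∑ k ∈ Finset.range (n + 1),
          lamZero k ^ (-s - 1) * (eps k - epsPrev k) := by
  have hpartial (m : ℕ) : ∑ k ∈ Finset.range (m + 1), (lam k - lamZero k) ≤
      ∑ k ∈ Finset.range (m + 1), qm / √Real.pi * (eps k - epsPrev k) := by
    rw [← Finset.mul_sum, sum_eps_sub_epsPrev]
    exact (sum_sub_lamZero_le hq hqpos hlam m).trans <| add_le_of_nonpos_left <|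
      mul_nonpos_of_nonneg_of_nonpos (omega_div_pi_nonneg m) hmean
  have hpos (k : ℕ) : 0 < lam k := hlam0.trans_le (hlam.monotone k.zero_le)
  have h := sum_rpow_neg_sub_le hpos lamZero_pos monotone_lamZero hpartial hs n
  simpa only [mul_left_comm _ (qm / √Real.pi), ← Finset.mul_sum, mul_assoc] using h

end PerturbedOscillator

end

theorem theorem6p3 (q : ℝ → ℝ) (hq : MeasureTheory.Integrable q MeasureTheory.volume)
    (qm : ℝ) (hqm : 0 ≤ qm)
    (hqpos : ∀ᵐ x ∂(MeasureTheory.volume : MeasureTheory.Measure ℝ),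
      0 ≤ q x + qm * Real.exp (-x ^ 2))
    (hmean : ∫ x, q x = 0)
    (lam : ℕ → ℝ)
    (hlam : PerturbedOscillator.IsEigenvalueSequence (PerturbedOscillator.potential q) lam)
    (hlam0 : 0 < lam 0)
    (n : ℕ) (s : ℝ) (hs : 0 < s) :
    ∑ k ∈ Finset.range (n + 1), lam k ^ (-s) ≥
      ∑ k ∈ Finset.range (n + 1), PerturbedOscillator.lamZero k ^ (-s)
        - s * qm * ∑ k ∈ Finset.range (n + 1),
            PerturbedOscillator.lamZero k ^ (-s - 1)
              * (PerturbedOscillator.eps k - PerturbedOscillator.epsPrev k) := by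
  -- `q_m` may be enlarged to `√π q_m`, which absorbs the factor `1 / √π`.
  have hqpos' : ∀ᵐ x, 0 ≤ q x + qm * √Real.pi * Real.exp (-x ^ 2) := hqpos.mono fun x hx => by
    have : qm ≤ qm * √Real.pi :=
      le_mul_of_one_le_right hqm (Real.one_le_sqrt.2 (by linarith [Real.pi_gt_three]))
    grw [← this]
    exact hx
  simpa only [mul_div_cancel_right₀ _ (Real.sqrt_pos.2 Real.pi_pos).ne'] using
    PerturbedOscillator.theorem6p3_general hq hqpos' hmean.le hlam hlam0 n hs.le
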